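/- Let $\mathbb F$ be a finite field, $D\subseteq\mathbb F$ with $|D|=d\ge 1$. Consider the matrix multiplication function $D^{2n^2}\to\mathbb F^{n^2}$, $(A,B)\mapsto AB$, for $n\times n$ matrices $A,B$ with entries in $D$. \emph{Branching programs.} A $D$-way branching program $P$ of time $T$ has layers $L_0,\dots,L_T$ of nodes, $L_0$ consisting of the root only. Each non-sink node of layer $t<T$ queries one entry of $A$ or $B$ and has one outgoing edge into layer $t+1$ for each value in $D$; each edge may carry output statements $((i,j),o)$ with $o\in\mathbb F$. On an input, $P$ succeeds if along the followed path every entry of $AB$ is output with its correct value and no wrong value is output. Its cumulative memory is $CM(P)=\sum_{t=0}^{T}\log_2|L_t|$. A randomized branching program is a probability distribution on branching programs; it has time at most $T$ and cumulative memory at most $S$ if all programs in its support do. \emph{Random-access machines.} A RAM is a finite list of instructions acting on registers that hold natural numbers (constants, arbitrary binary operations, indirect load and store, jump on zero, random-access reading of the read-only input, writing of a statement (index, value) to the write-only output); field elements are represented by natural numbers through an arbitrary injection, the two matrices are stored in row-major order, and the index of an output entry is its row-major position. Every instruction takes unit time. The space of a configuration is the sum, over the registers with nonzero content, of the bit length of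 the address plus the bit length of the content. The cumulative memory on an input is the sum of the space over all times from the start until halting. The machine has time at most $T$ and cumulative memory at most $S$ if this is so on every input from $D^{2n^2}$. It succeeds on an input if it outputs exactly the entries of $AB$. A randomized RAM is a probability distribution on such programs, and a bound on time, cumulative memory or program length is required for all programs in its support. \textbf{Theorem.} Let $c\in\mathbb R$. (a) There are $\varepsilon>0$ and $n_0$, depending only on $c$, such that for all $n\ge n_0$ and all $\mathbb F$, $D$, $d$ as above: if a (randomized) $D$-way branching program with time at most $T$ and cumulative memory at most $S$ correctly multiplies two independent uniformly random matrices in $D^{n\times n}$ with probability at least $n^{-c}$ (over the inputs and the program), then $$T\ \ge\ \varepsilon\,\frac{n^3\sqrt{\log_2 d}}{\log_2 n}\qquad\text{or}\qquad T\cdot S\ \ge\ \varepsilon\, n^6\log_2 d ,$$ that is, the time is $\Omega(n^3\sqrt{\log d}/\log n)$ or the cumulative memory is $\Omega(n^6\log d/T)$. (b) There is $\varepsilon>0$, depending only on $c$, such that for every $\ell$ there is $n_0$, depending only on $c$ and $\ell$, such that for all $n\ge n_0$ and all $\mathbb F$, $D$, $d$ as above: if a (randomized) random-access machine with at most $\ell$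 instructions, time at most $T$ and cumulative memory at most $S$ correctly multiplies two independent uniformly random matrices in $D^{n\times n}$ with probability at least $n^{-c}$, then $T\cdot S\ge\varepsilon\, n^6\log_2 d$, without any condition on $T$. -/

import Mathlib

open scoped BigOperators

universe u

/-- A layered `D`-way branching program reading an input `x : ι → D` and producing ordered outputs,
i.e. statements `(j, o)` with output index `j : κ` and value `o : R`. Layer `t` is `Fin (width t)`.
Only layers `0, …, time` and the edges leaving layers `0, …, time - 1` matter. -/
structure BranchingProgram (ι κ D R : Type*) where
  /-- the number of steps `T`; the program has the `T + 1` layers `0, …, T` -/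
  time : ℕ
  /-- the number of nodes in layer `t` -/
  width : ℕ → ℕ
  /-- the root is the only node of layer `0` -/
  width_zero : width 0 = 1
  /-- the input coordinate queried at a node; `none` means that the node is a sink -/
  query : ∀ t, Fin (width t) → Option ι
  /-- the end of the edge leaving a node for a given value of the queried coordinate -/
  next : ∀ t, Fin (width t) → D → Fin (width (t + 1))
  /-- the output statements on that edge -/
  out : ∀ t, Fin (width t) → D → List (κ × R)

namespace BranchingProgram

variable {ι κ D R : Type*}

/-- The node in layer `t` reached on input `x`; `none` if a sink was reached in an earlier layer. -/
def node (P : BranchingProgram ι κ D R) (x : ι → D) : (t : ℕ) → Option (Fin (P.width t))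
  | 0 => some ⟨0, by simp [P.width_zero]⟩
  | t + 1 => (P.node x t).bind fun v => (P.query t v).map fun i => P.next t v (x i)

/-- On input `x` the program produces the output statement `(j, o)`. -/
def Emits (P : BranchingProgram ι κ D R) (x : ι → D) (j : κ) (o : R) : Prop :=
  ∃ t < P.time, ∃ v i, P.node x t = some v ∧ P.query t v = some i ∧ (j, o) ∈ P.out t v (x i)

/-- On input `x` the program produces the vector `y`: every entry of `y` is output (in any time
order) and no wrong value is ever output. -/
def Produces (P : BranchingProgram ι κ D R) (x : ι → D) (y : κ → R) : Prop :=
  ∀ j o, P.Emits x j o ↔ o = y j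

/-- Cumulative memory: the sum over all layers of the logarithm of the number of nodes. -/
noncomputable def cumulativeMemory (P : BranchingProgram ι κ D R) : ℝ :=
  ∑ t ∈ Finset.range (P.time + 1), Real.logb 2 (P.width t)

end BranchingProgram

namespace RAM

/-- Instructions of a random-access machine with registers `0, 1, 2, …` holding natural numbers,
a read-only random-access input and a write-only output. Any binary operation on natural numbers
(addition, multiplication, bit operations, field operations in an encoding, …) may be used as a
single instruction. -/
inductive Instr where
  /-- `reg dst := k` -/
  | const (dst k : ℕ)
  /-- `reg dst := f (reg a) (reg b)` -/
  | op (f : ℕ → ℕ → ℕ) (dst a b : ℕ)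
  /-- `reg dst := reg (reg a)` -/
  | load (dst a : ℕ)
  /-- `reg (reg a) := reg b` -/
  | store (a b : ℕ)
  /-- `reg dst := input (reg a)` -/
  | read (dst a : ℕ)
  /-- output the statement `(reg a, reg b)` -/
  | write (a b : ℕ)
  /-- continue at instruction `l` if `reg a = 0` -/
  | jumpIfZero (a l : ℕ)

/-- A program; the machine halts when the program counter leaves the list. -/
abbrev Program := List Instr

/-- A configuration: program counter and register contents (almost all of them zero). -/
structure Config where
  pc : ℕ
  reg : ℕ →₀ ℕ

/-- Logarithmic-cost space: every register in use (that is, with nonzero content) is charged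
the bit length of its address plus the bit length of its content. -/
def Config.space (s : Config) : ℕ :=
  ∑ r ∈ s.reg.support, (Nat.size r + Nat.size (s.reg r))

/-- The machine has halted. -/
def Halted (M : Program) (s : Config) : Prop := M.length ≤ s.pc

/-- One (unit-cost) step on the input `w`. -/
noncomputable def step (M : Program) (w : ℕ → ℕ) (s : Config) : Config :=
  match M[s.pc]? with
  | none => s
  | some (.const dst k) => ⟨s.pc + 1, s.reg.update dst k⟩
  | some (.op f dst a b) => ⟨s.pc + 1, s.reg.update dst (f (s.reg a) (s.reg b))⟩
  | some (.load dst a) => ⟨s.pc + 1, s.reg.update dst (s.reg (s.reg a))⟩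
  | some (.store a b) => ⟨s.pc + 1, s.reg.update (s.reg a) (s.reg b)⟩
  | some (.read dst a) => ⟨s.pc + 1, s.reg.update dst (w (s.reg a))⟩
  | some (.write _ _) => ⟨s.pc + 1, s.reg⟩
  | some (.jumpIfZero a l) => ⟨if s.reg a = 0 then l else s.pc + 1, s.reg⟩

/-- The configuration after `t` steps, started at instruction `0` with all registers zero. -/
noncomputable def config (M : Program) (w : ℕ → ℕ) (t : ℕ) : Config :=
  (step M w)^[t] ⟨0, 0⟩

/-- On input `w` the machine outputs the statement `(k, v)` at some step. -/
def Emits (M : Program) (w : ℕ → ℕ) (k v : ℕ) : Prop :=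
  ∃ t a b, M[(config M w t).pc]? = some (.write a b) ∧
    (config M w t).reg a = k ∧ (config M w t).reg b = v

/-- On input `w` the machine halts after some number `τ ≤ T` of steps, and its cumulative memory
on this input, the sum of the space used at times `0, …, τ`, is at most `S`. -/
def RunsWithin (M : Program) (w : ℕ → ℕ) (T S : ℕ) : Prop :=
  ∃ τ ≤ T, Halted M (config M w τ) ∧ (∀ t < τ, ¬ Halted M (config M w t)) ∧
    ∑ t ∈ Finset.range (τ + 1), (config M w t).space ≤ S

end RAM

namespace MatMul

/-- Indices of the `2 n²` input entries: `inl (i, j)` is the entry `(i, j)` of the first matrix,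
`inr (i, j)` that of the second. -/
abbrev Idx (n : ℕ) := (Fin n × Fin n) ⊕ (Fin n × Fin n)

variable {F : Type*} {n : ℕ} {D : Finset F}

/-- The first input matrix. -/
def left (x : Idx n → D) : Matrix (Fin n) (Fin n) F := fun i j => (x (.inl (i, j)) : F)

/-- The second input matrix. -/
def right (x : Idx n → D) : Matrix (Fin n) (Fin n) F := fun i j => (x (.inr (i, j)) : F)

/-- The matrix multiplication function `D^{2n²} → F^{n²}`. -/
def product [Field F] (x : Idx n → D) (p : Fin n × Fin n) : F := (left x * right x) p.1 p.2

/-- The input as seen by a random-access machine: cells `0, …, n² - 1` hold the first matrix in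
row-major order, cells `n², …, 2n² - 1` the second one, field elements being represented by natural
numbers through `enc`. -/
def tape (enc : F ↪ ℕ) (x : Idx n → D) (k : ℕ) : ℕ :=
  if h : k < n * n then enc (x (.inl (finProdFinEquiv.symm ⟨k, h⟩)))
  else if h : k - n * n < n * n then enc (x (.inr (finProdFinEquiv.symm ⟨k - n * n, h⟩)))
  else 0

/-- The machine outputs the product on input `x`: every entry `(i, j)` is output under its row-major
index, and nothing else is output. -/
def RAMProduces [Field F] (M : RAM.Program) (enc : F ↪ ℕ) (x : Idx n → D) : Prop :=
  ∀ k v, RAM.Emits M (tape enc x) k v ↔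
    ∃ i j : Fin n, k = i * n + j ∧ v = enc (product x (i, j))

/-- The probability of the event `E` for a uniformly random pair of matrices with entries in `D`. -/
noncomputable def prob (E : (Idx n → D) → Prop) : ℝ :=
  (Nat.card {x // E x} : ℝ) / Nat.card (Idx n → D)

end MatMul

/-! By averaging, a randomized program may be replaced by a deterministic one in its support that
succeeds with probability at least n^(-c). Write d = |D|.

Call a matrix rigid if, after any h rows are deleted, any set of at most h columns still contains at
least half as many independent ones; here h is about n/64. Almost all matrices over D are rigid
(`exists_card_not_rigid_le`). Let both factors be rigid, let q entries be known and k outputs be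
prescribed, with q² ≤ h²k. Rows of the first factor and columns of the second with more than h known
entries are so rare that at most k/4 outputs lie on two of them. The others lie on a light row or a
light column, and once the opposite factor is fixed they give Ω(k) independent equations on unknown
entries (`card_correct_mul_le`). So, from a fixed state, q steps yield k correct outputs with
probability d^(-Ω(k)) (`card_advances_mul_le`).

A union bound over states follows. With Λ = Θ(κ log d) and w = Θ(n√κ), a block of length at most
2^(i+1) w that starts with memory at most 4^i Λ yields fewer than κ 4^i outputs, on all but few
inputs. Time is cut into such blocks greedily from the end, each of the least possible kind i
(`exists_block_decomposition`). By minimality, a block of kind i ≥ 1 contains a long stretch of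
large memory. Its length, outputs and cumulative memory scale as 2^i, 4^i and 8^i. Since (4^i)² =
2^i · 8^i, Cauchy–Schwarz bounds the square of the number of outputs by time times cumulative memory
(`sq_mul_le_cumulative`).

The parameter κ cancels in the result. The union bound over starting times only asks for κ log d ≳
log n. The blocks of kind 0 produce at most half of the outputs as long as T ≲ n³ √(log d / log n),
and this is where a condition on time enters.

For random-access machines the condition is automatic. A halting computation repeats no
configuration, so it uses Ω(log n) space most of the time (`RAM.time_mul_log_le`). Hence τ log n ≲
S, and a small product T · S forces τ below the threshold. -/

namespace MatMul

/-! ### Linear algebra and counting of left factors -/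

/-- Linearly independent columns (on the rows in `U`) admit a nonsingular square submatrix. -/
theorem exists_nonsingular_rows {F α : Type*} [Field F] [Fintype α] [DecidableEq α]
    (M : Matrix α α F) (U J : Finset α)
    (h : LinearIndependent F (fun j : J => fun u : U => M u j)) :
    ∃ I ⊆ U, I.card = J.card ∧
      (∀ a : α → F, (∀ j ∈ J, ∑ u ∈ I, a u * M u j = 0) → ∀ u ∈ I, a u = 0) ∧
      (∀ b : J → F, (∀ u ∈ I, ∑ j : J, b j * M u j = 0) → b = 0) := by
  classical
  let N : Matrix U J F := fun u j => M u j
  have hr : N.rank = Fintype.card J := by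
    rw [← Matrix.rank_transpose]
    exact LinearIndependent.rank_matrix (M := N.transpose) h
  -- Row rank equals column rank, so the rows span everything and a basis chosen among them has
  -- exactly |J| members.
  have hspan : Submodule.span F (Set.range N) = ⊤ := by
    apply Submodule.eq_top_of_finrank_eq
    have := Matrix.rank_eq_finrank_span_row N
    rw [hr] at this
    rw [Module.finrank_fintype_fun_eq_card, this]
    rfl
  obtain ⟨κ, a, ha, hsp, hli⟩ := exists_linearIndependent' F (N : U → J → F)
  have : Finite κ := Finite.of_injective a ha
  have := Fintype.ofFinite κ
  have hcard : Fintype.card κ = J.card := by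
    have := linearIndependent_iff_card_eq_finrank_span.1 hli
    rw [this, Set.finrank, hsp, hspan, finrank_top, Module.finrank_fintype_fun_eq_card,
      Fintype.card_coe]
  have hinj : Function.Injective (fun k => (a k : α)) := Subtype.val_injective.comp ha
  refine ⟨Finset.univ.image (fun k => (a k : α)), ?_, ?_, ?_, ?_⟩
  · intro u hu
    obtain ⟨k, -, rfl⟩ := Finset.mem_image.1 hu
    exact (a k).2
  · rw [Finset.card_image_of_injective _ hinj, Finset.card_univ, hcard]
  · intro c hc u hu
    obtain ⟨k, -, rfl⟩ := Finset.mem_image.1 hu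
    refine Fintype.linearIndependent_iff.1 hli (fun k => c (a k)) ?_ k
    funext j
    have := hc j j.2
    rw [Finset.sum_image (fun x _ y _ h => hinj h)] at this
    simpa [Finset.sum_apply, N] using this
  · intro b hb
    -- The coefficients b are read as a functional; it vanishes on the chosen rows, which span.
    let φ : (J → F) →ₗ[F] F := ∑ j, b j • LinearMap.proj j
    have hφ : φ = 0 := by
      apply LinearMap.ext_on_range (v := (N : U → J → F) ∘ a)
      · rw [hsp, hspan]
      · intro k
        have := hb (a k) (Finset.mem_image_of_mem _ (Finset.mem_univ k))
        simpa [φ, N] using this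
    funext j
    have := LinearMap.congr_fun hφ (Pi.single j 1)
    simpa [φ, Pi.single_apply] using this

/-- A family of functions determined by their values on `W` has at most `|D| ^ |W|` members. -/
theorem card_le_pow_of_determined {α δ : Type*} [Fintype α] [DecidableEq α] [Fintype δ]
    [DecidableEq δ] (S : Finset (α → δ)) (W : Finset α)
    (h : ∀ a ∈ S, ∀ b ∈ S, (∀ i ∈ W, a i = b i) → a = b) :
    S.card ≤ Fintype.card δ ^ W.card := by
  classical
  have : S.card ≤ (Finset.univ : Finset (W → δ)).card := by
    apply Finset.card_le_card_of_injOn (fun a => fun i : W => a i)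
    · intro a _; simp
    · intro a ha b hb hab
      exact h a ha b hb (fun i hi => congrFun hab ⟨i, hi⟩)
  simpa using this

theorem card_agree_mul {α δ : Type*} [Fintype α] [DecidableEq α] [Fintype δ]
    [DecidableEq δ] (Q : Finset α) (x₀ : α → δ) :
    (Finset.univ.filter fun a : α → δ => ∀ i ∈ Q, a i = x₀ i).card * Fintype.card δ ^ Q.card
      = Fintype.card δ ^ Fintype.card α := by
  classical
  have : (Finset.univ.filter fun a : α → δ => ∀ i ∈ Q, a i = x₀ i)
      = Fintype.piFinset (fun i => if i ∈ Q then {x₀ i} else Finset.univ) := by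
    ext a
    simp only [Finset.mem_filter, Finset.mem_univ, true_and, Fintype.mem_piFinset]
    refine forall_congr' fun i => ?_
    split_ifs with h <;> simp [h]
  have h1 : ∀ i : α, (if i ∈ Q then ({x₀ i} : Finset δ) else Finset.univ).card
      = if i ∈ Q then 1 else Fintype.card δ := by
    intro i; split_ifs <;> simp
  rw [this, Fintype.card_piFinset, Finset.prod_congr rfl (fun i _ => h1 i), Finset.prod_ite,
    Finset.prod_const_one, one_mul, Finset.prod_const, ← pow_add]
  have := Finset.card_filter_add_card_filter_not (s := (Finset.univ : Finset α)) (· ∈ Q)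
  rw [Finset.filter_univ_mem, Finset.card_univ] at this
  rw [← this, add_comm]

variable {F : Type*} [Field F] [DecidableEq F] {α : Type*} [Fintype α] [DecidableEq α]

/-- Rows over `D` that are prescribed outside `U` and solve a linear system of full rank. -/
theorem card_solutions_mul_le (D : Finset F) (M : Matrix α α F) (U J : Finset α)
    (h : LinearIndependent F (fun j : J => fun u : U => M u j)) (a₀ : α → D) (y : α → F) :
    (Finset.univ.filter fun a : α → D =>
        (∀ u ∉ U, a u = a₀ u) ∧ ∀ j ∈ J, ∑ u, (a u : F) * M u j = y j).card * D.card ^ J.card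
      ≤ D.card ^ U.card := by
  classical
  obtain ⟨I, hIU, hI, hdet, -⟩ := exists_nonsingular_rows M U J h
  -- The entries on I are determined by the others: the difference of two solutions agreeing off I
  -- is supported on I, where the square system is nonsingular.
  have := card_le_pow_of_determined (Finset.univ.filter fun a : α → D =>
        (∀ u ∉ U, a u = a₀ u) ∧ ∀ j ∈ J, ∑ u, (a u : F) * M u j = y j) (U \ I) (by
    intro a ha b hb hab
    simp only [Finset.mem_filter, Finset.mem_univ, true_and] at ha hb
    have hout : ∀ u ∉ I, a u = b u := by
      intro u hu
      by_cases hU : u ∈ U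
      · exact hab u (by simp [hU, hu])
      · rw [ha.1 u hU, hb.1 u hU]
    have hz := hdet (fun u => (a u : F) - b u) (by
      intro j hj
      have h1 : ∑ u, ((a u : F) - b u) * M u j = 0 := by
        simp only [sub_mul, Finset.sum_sub_distrib, ha.2 j hj, hb.2 j hj, sub_self]
      rw [← h1]
      apply Finset.sum_subset (Finset.subset_univ _)
      intro u _ hu
      simp [hout u hu])
    funext u
    by_cases hu : u ∈ I
    · exact Subtype.ext (sub_eq_zero.1 (hz u hu))
    · exact hout u hu)
  rw [Fintype.card_coe] at this
  calc _ ≤ D.card ^ (U \ I).card * D.card ^ J.card := Nat.mul_le_mul_right _ this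
    _ = D.card ^ U.card := by
      rw [← pow_add, ← hI, Finset.card_sdiff_add_card_eq_card hIU]

open scoped Classical in
/-- Vectors over `D` whose restriction to `U` lies in the span of given independent columns. -/
theorem card_span_mul_le (D : Finset F) (M : Matrix α α F) (U J : Finset α)
    (h : LinearIndependent F (fun j : J => fun u : U => M u j)) :
    (Finset.univ.filter fun a : α → D => ∃ b : J → F,
        ∀ u ∈ U, (a u : F) = ∑ j, b j * M u j).card
      ≤ D.card ^ ((Finset.univ \ U).card + J.card) := by
  classical
  obtain ⟨I, hIU, hI, -, hdet⟩ := exists_nonsingular_rows M U J h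
  -- The entries on I fix the coefficients and thereby all entries on U; those outside U are free.
  have := card_le_pow_of_determined (Finset.univ.filter fun a : α → D => ∃ b : J → F,
        ∀ u ∈ U, (a u : F) = ∑ j, b j * M u j) ((Finset.univ \ U) ∪ I) (by
    intro a ha b hb hab
    simp only [Finset.mem_filter, Finset.mem_univ, true_and] at ha hb
    obtain ⟨β, hβ⟩ := ha
    obtain ⟨β', hβ'⟩ := hb
    have hz := hdet (β - β') (by
      intro u hu
      simp only [Pi.sub_apply, sub_mul, Finset.sum_sub_distrib]
      rw [← hβ u (hIU hu), ← hβ' u (hIU hu), hab u (by simp [hu]), sub_self])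
    have hββ : β = β' := sub_eq_zero.1 hz
    funext u
    by_cases hu : u ∈ U
    · exact Subtype.ext (by rw [hβ u hu, hβ' u hu, hββ])
    · exact hab u (by simp [hu]))
  rw [Fintype.card_coe] at this
  refine this.trans (le_of_eq ?_)
  congr 1
  rw [Finset.card_union_of_disjoint, hI]
  rw [Finset.disjoint_left]
  intro u hu hu'
  simp at hu
  exact hu (hIU hu')

/-- Every set of at most `h` columns contains, after deleting any `h` rows, at least half as many
linearly independent ones. -/
def Rigid (h : ℕ) (M : Matrix α α F) : Prop :=
  ∀ U O : Finset α, Fintype.card α ≤ U.card + h → O.card ≤ h →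
    ∃ J ⊆ O, O.card ≤ 2 * J.card ∧ LinearIndependent F (fun j : J => fun u : U => M u j)

/-- Left factors with prescribed entries on `Q`, when the product with a rigid matrix is prescribed
on `O`, where every row meeting `O` has few prescribed entries. -/
theorem card_left_factors_mul_le (D : Finset F) (hD : 1 ≤ D.card) (h : ℕ)
    (hh : Fintype.card α ≤ 128 * h)
    (N : Matrix α α F) (hN : Rigid h N) (Q : Finset (α × α)) (x₀ : α × α → D)
    (O : Finset (α × α))
    (hO : ∀ p ∈ O, (Finset.univ.filter fun k => (p.1, k) ∈ Q).card ≤ h) (y : α × α → F)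
    (R : ℕ) (hR : 256 * R < O.card + 256) :
    (Finset.univ.filter fun a : α × α → D => (∀ p ∈ Q, a p = x₀ p) ∧
        ∀ p ∈ O, ∑ k, (a (p.1, k) : F) * N k p.2 = y p).card * (D.card ^ R * D.card ^ Q.card)
      ≤ D.card ^ (Fintype.card α * Fintype.card α) := by
  classical
  let Qr : α → Finset α := fun i => Finset.univ.filter fun k => (i, k) ∈ Q
  let Or : α → Finset α := fun i => Finset.univ.filter fun k => (i, k) ∈ O
  have key : ∀ i, ∃ J ⊆ Or i, (Or i).card ≤ 256 * J.card ∧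
      LinearIndependent F (fun j : J => fun u : (Finset.univ \ Qr i : Finset α) => N u j) := by
    intro i
    by_cases hi : (Or i).Nonempty
    · obtain ⟨k, hk⟩ := hi
      have hQ : (Qr i).card ≤ h := hO (i, k) (by simpa [Or] using hk)
      -- Rigidity handles at most h columns at once. Truncation to h of at most n ≤ 128h columns
      -- loses a factor 128 and rigidity a factor 2, whence 256.
      obtain ⟨O', hO', hc⟩ := Finset.exists_subset_card_eq (s := Or i) (n := min (Or i).card h)
        (min_le_left _ _)
      have hu : Fintype.card α ≤ (Finset.univ \ Qr i).card + h := by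
        rw [Finset.card_sdiff_of_subset (Finset.subset_univ _), Finset.card_univ]; omega
      obtain ⟨J, hJ, hJc, hli⟩ := hN (Finset.univ \ Qr i) O' hu (by omega)
      refine ⟨J, hJ.trans hO', ?_, hli⟩
      have : (Or i).card ≤ Fintype.card α := Finset.card_le_univ _
      omega
    · refine ⟨∅, by simp, ?_, linearIndependent_empty_type⟩
      rw [Finset.not_nonempty_iff_eq_empty.1 hi]; simp
  choose J hJO hJc hli using key
  let S : α → Finset (α → D) := fun i => Finset.univ.filter fun a : α → D =>
        (∀ u ∉ Finset.univ \ Qr i, a u = x₀ (i, u)) ∧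
          ∀ j ∈ J i, ∑ u, (a u : F) * N u j = y (i, j)
  have hS : ∀ i, (S i).card * (D.card ^ (J i).card * D.card ^ (Qr i).card)
      ≤ D.card ^ Fintype.card α := by
    intro i
    have := card_solutions_mul_le D N (Finset.univ \ Qr i) (J i) (hli i) (fun u => x₀ (i, u))
      (fun j => y (i, j))
    rw [← mul_assoc]
    refine (Nat.mul_le_mul_right _ this).trans (le_of_eq ?_)
    rw [← pow_add, Finset.card_sdiff_add_card_eq_card (Finset.subset_univ _), Finset.card_univ]
  have hle : (Finset.univ.filter fun a : α × α → D => (∀ p ∈ Q, a p = x₀ p) ∧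
        ∀ p ∈ O, ∑ k, (a (p.1, k) : F) * N k p.2 = y p).card ≤ (Fintype.piFinset S).card := by
    apply Finset.card_le_card_of_injOn (fun a => fun i k => a (i, k))
    · intro a ha
      simp only [Finset.coe_filter, Finset.mem_univ, true_and, Set.mem_ofPred_eq] at ha
      simp only [Finset.mem_coe, Fintype.mem_piFinset]
      intro i
      simp only [S, Finset.mem_filter, Finset.mem_univ, true_and]
      constructor
      · intro u hu
        exact ha.1 (i, u) (by simpa [Qr] using hu)
      · intro j hj
        exact ha.2 (i, j) (by simpa [Or] using hJO i hj)
    · intro a _ b _ hab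
      funext p
      exact congrFun (congrFun hab p.1) p.2
  have hsumQ : ∑ i, (Qr i).card = Q.card := by
    rw [Finset.card_eq_sum_card_fiberwise (f := Prod.fst) (t := Finset.univ) (by intro; simp)]
    refine Finset.sum_congr rfl fun i _ => ?_
    apply Finset.card_bij (fun k _ => (i, k))
    · intro k hk; simpa [Qr] using hk
    · intro a _ b _ hab; simpa using hab
    · rintro ⟨i', k⟩ hp
      simp only [Finset.mem_filter] at hp
      obtain ⟨hp, rfl⟩ := hp
      exact ⟨k, by simpa [Qr] using hp, rfl⟩
  have hsumO : ∑ i, (Or i).card = O.card := by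
    rw [Finset.card_eq_sum_card_fiberwise (f := Prod.fst) (t := Finset.univ) (by intro; simp)]
    refine Finset.sum_congr rfl fun i _ => ?_
    apply Finset.card_bij (fun k _ => (i, k))
    · intro k hk; simpa [Or] using hk
    · intro a _ b _ hab; simpa using hab
    · rintro ⟨i', k⟩ hp
      simp only [Finset.mem_filter] at hp
      obtain ⟨hp, rfl⟩ := hp
      exact ⟨k, by simpa [Or] using hp, rfl⟩
  have hRJ : R ≤ ∑ i, (J i).card := by
    have : ∑ i, (Or i).card ≤ ∑ i, 256 * (J i).card := Finset.sum_le_sum fun i _ => hJc i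
    rw [hsumO, ← Finset.mul_sum] at this
    omega
  calc _ ≤ (Fintype.piFinset S).card * (D.card ^ (∑ i, (J i).card) * D.card ^ (∑ i, (Qr i).card)) := by
        rw [hsumQ]
        gcongr
    _ = ∏ i, ((S i).card * (D.card ^ (J i).card * D.card ^ (Qr i).card)) := by
        rw [Fintype.card_piFinset, Finset.prod_mul_distrib, Finset.prod_mul_distrib,
          Finset.prod_pow_eq_pow_sum, Finset.prod_pow_eq_pow_sum]
    _ ≤ ∏ _i : α, D.card ^ Fintype.card α := Finset.prod_le_prod' fun i _ => hS i
    _ = _ := by rw [Finset.prod_const, Finset.card_univ, ← pow_mul]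

end MatMul

/-! ### Rigid pairs with known entries and prescribed outputs -/

namespace MatMul

/-- Serves to count pairs of matrices, one factor over each value of the other. Savings are kept as
multipliers m₁, m₂ so that powers of d need not be divided. -/
theorem card_mul_le_of_fibers {β γ : Type*} [DecidableEq γ] (S : Finset β) (T : Finset γ)
    (f : β → γ) (hf : ∀ x ∈ S, f x ∈ T) {m₁ m₂ t₁ t₂ : ℕ} (hm : 0 < m₁)
    (hfib : ∀ b ∈ T, (S.filter fun x => f x = b).card * m₁ ≤ t₁) (hT : T.card * m₂ ≤ t₂) :
    S.card * (m₁ * m₂) ≤ t₁ * t₂ := by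
  have h := Finset.card_le_mul_card_image_of_maps_to (s := S) (t := T) (f := f) hf (t₁ / m₁)
    (fun b hb => (Nat.le_div_iff_mul_le hm).2 (hfib b hb))
  calc S.card * (m₁ * m₂) ≤ (t₁ / m₁ * T.card) * (m₁ * m₂) := Nat.mul_le_mul_right _ h
    _ = (t₁ / m₁ * m₁) * (T.card * m₂) := by ring
    _ ≤ t₁ * t₂ := Nat.mul_le_mul (Nat.div_mul_le_self _ _) hT

theorem card_heavy_mul_le {α : Type*} [Fintype α] [DecidableEq α] (Q : Finset (α × α)) (h : ℕ) :
    (Finset.univ.filter fun i => h < (Finset.univ.filter fun k => (i, k) ∈ Q).card).card * (h + 1)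
      ≤ Q.card := by
  classical
  set H := Finset.univ.filter fun i => h < (Finset.univ.filter fun k => (i, k) ∈ Q).card with hH
  have h1 : H.card * (h + 1) ≤ ∑ i ∈ H, (Finset.univ.filter fun k => (i, k) ∈ Q).card := by
    rw [← smul_eq_mul]
    apply Finset.card_nsmul_le_sum
    intro i hi
    rw [hH, Finset.mem_filter] at hi
    exact hi.2
  refine h1.trans ?_
  rw [← Finset.card_sigma]
  apply Finset.card_le_card_of_injOn (fun p => (p.1, p.2))
  · rintro ⟨i, k⟩ hp
    simp only [Finset.coe_sigma, Set.mem_sigma_iff, Finset.mem_coe, Finset.mem_filter,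
      Finset.mem_univ, true_and] at hp
    exact hp.2
  · rintro ⟨i, k⟩ _ ⟨i', k'⟩ _ hab
    simp only [Prod.mk.injEq] at hab
    obtain ⟨rfl, rfl⟩ := hab
    rfl

variable {F : Type*} [Field F] [DecidableEq F] {n : ℕ}

open scoped Classical in
/-- Few pairs of rigid matrices that agree with `x₀` on `Q` have a prescribed product on `O`. -/
theorem card_correct_mul_le (D : Finset F) (hD : 1 ≤ D.card) (h : ℕ) (hh : n ≤ 128 * h)
    (Q : Finset (Idx n)) (x₀ : Idx n → D) (O : Finset (Fin n × Fin n)) (y : Fin n × Fin n → F)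
    (k R : ℕ) (hk : k ≤ O.card) (hQ : Q.card ^ 2 ≤ h ^ 2 * k) (hR : 1024 * R < k + 1024) :
    (Finset.univ.filter fun x : Idx n → D => (∀ i ∈ Q, x i = x₀ i) ∧ Rigid h (right x) ∧
        Rigid h (left x).transpose ∧ ∀ p ∈ O, product x p = y p).card
      * (D.card ^ R * D.card ^ Q.card) ≤ D.card ^ (n * n) * D.card ^ (n * n) := by
  set S := Finset.univ.filter fun x : Idx n → D => (∀ i ∈ Q, x i = x₀ i) ∧ Rigid h (right x) ∧
        Rigid h (left x).transpose ∧ ∀ p ∈ O, product x p = y p with hS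
  set QA := Q.toLeft with hQA
  let QB : Finset (Fin n × Fin n) := Q.toRight
  let QB' : Finset (Fin n × Fin n) := QB.map (Equiv.prodComm _ _).toEmbedding
  have hQB' : ∀ i j, (i, j) ∈ QB' ↔ (j, i) ∈ QB := by
    intro i j
    simp [QB', Finset.mem_map_equiv]
  have hQBc : QB'.card = QB.card := Finset.card_map _
  have hQc : QA.card + QB.card = Q.card := Finset.card_toLeft_add_card_toRight
  set HA := Finset.univ.filter fun i => h < (Finset.univ.filter fun k => (i, k) ∈ QA).card with hHA
  set HB := Finset.univ.filter fun i => h < (Finset.univ.filter fun k => (i, k) ∈ QB').card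
    with hHB
  have cA : HA.card * (h + 1) ≤ QA.card := card_heavy_mul_le QA h
  have cB : HB.card * (h + 1) ≤ QB.card := hQBc ▸ card_heavy_mul_le QB' h
  -- By AM–GM, |QA| |QB| ≤ |Q|²/4 ≤ h²k/4, so at most a quarter of the outputs lie in a heavy row
  -- and a heavy column at once.
  have hheavy : 4 * (HA.card * HB.card) ≤ k := by
    have h1 : (HA.card * (h + 1)) * (HB.card * (h + 1)) ≤ QA.card * QB.card :=
      Nat.mul_le_mul cA cB
    have h2 : 4 * (QA.card * QB.card) ≤ Q.card ^ 2 := by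
      rw [← hQc]; nlinarith [sq_nonneg ((QA.card : ℤ) - QB.card)]
    have h3 : h ^ 2 * k ≤ (h + 1) ^ 2 * k := by gcongr; omega
    have h4 : (h + 1) ^ 2 * (4 * (HA.card * HB.card)) ≤ (h + 1) ^ 2 * k := by
      calc _ = 4 * ((HA.card * (h + 1)) * (HB.card * (h + 1))) := by ring
        _ ≤ _ := by omega
    exact Nat.le_of_mul_le_mul_left h4 (by positivity)
  let O₁ := O.filter fun p => p.1 ∉ HA
  let O₂ := O.filter fun p => p.2 ∉ HB
  have hO : O.card ≤ O₁.card + O₂.card + HA.card * HB.card := by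
    have : O ⊆ (O₁ ∪ O₂) ∪ (HA ×ˢ HB) := by
      intro p hp
      simp only [Finset.mem_union, O₁, O₂, Finset.mem_filter, Finset.mem_product, hp, true_and]
      tauto
    refine (Finset.card_le_card this).trans ((Finset.card_union_le _ _).trans ?_)
    rw [Finset.card_product]
    exact Nat.add_le_add_right (Finset.card_union_le _ _) _
  have hpos : ∀ m, 0 < D.card ^ m := fun m => Nat.pow_pos hD
  -- The outputs off the heavy rectangle are at least three quarters of O, so one light part has at
  -- least a quarter of O. This factor 4 turns 256 into 1024.
  rcases (by omega : O.card ≤ 4 * O₁.card ∨ O.card ≤ 4 * O₂.card) with h1 | h1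
  · have := card_mul_le_of_fibers S
      (Finset.univ.filter fun b : Fin n × Fin n → D => ∀ i ∈ QB, b i = x₀ (.inr i))
      (fun x p => x (.inr p)) (m₁ := D.card ^ R * D.card ^ QA.card) (m₂ := D.card ^ QB.card)
      (t₁ := D.card ^ (n * n)) (t₂ := D.card ^ (n * n)) (by
        intro x hx
        simp only [hS, Finset.mem_filter, Finset.mem_univ, true_and] at hx ⊢
        intro i hi
        exact hx.1 _ (by simpa [QB] using hi)) (Nat.mul_pos (hpos _) (hpos _)) (by
        intro b _
        by_cases hr : Rigid h (fun i j => (b (i, j) : F) : Matrix (Fin n) (Fin n) F)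
        swap
        · rw [Finset.card_eq_zero.2, zero_mul]; · exact Nat.zero_le _
          rw [Finset.filter_eq_empty_iff]
          rintro x hx rfl
          simp only [hS, Finset.mem_filter, Finset.mem_univ, true_and] at hx
          exact hr hx.2.1
        have h2 := card_left_factors_mul_le D hD h (by simpa using hh) _ hr QA
          (fun p => x₀ (.inl p)) O₁ (by
            intro p hp
            simpa [O₁, hHA] using (Finset.mem_filter.1 hp).2) y R (by omega)
        rw [Fintype.card_fin] at h2
        refine le_trans (Nat.mul_le_mul_right _ ?_) h2
        apply Finset.card_le_card_of_injOn (fun x p => x (.inl p))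
        · intro x hx
          simp only [hS, Finset.coe_filter, Finset.mem_filter, Finset.mem_univ, true_and,
            Set.mem_ofPred_eq] at hx ⊢
          obtain ⟨hx, rfl⟩ := hx
          refine ⟨fun p hp => hx.1 _ (by simpa [QA] using hp), fun p hp => ?_⟩
          have := hx.2.2.2 p (Finset.mem_filter.1 hp).1
          rw [← this, product, Matrix.mul_apply]
          rfl
        · intro x hx x' hx' hxx
          simp only [Finset.coe_filter, Set.mem_ofPred_eq] at hx hx'
          funext i
          rcases i with i | i
          · exact congrFun hxx i
          · exact congrFun (hx.2.trans hx'.2.symm) i) (by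
        have := card_agree_mul QB (fun p => x₀ (.inr p))
        rw [Fintype.card_coe, Fintype.card_prod, Fintype.card_fin] at this
        convert this.le)
    rwa [mul_assoc, ← pow_add, ← pow_add, hQc, pow_add] at this
  -- Mirror case: columns of the second factor are rows of its transpose, and the transposed first
  -- factor is rigid, so the row count applies with index pairs swapped.
  · have := card_mul_le_of_fibers S
      (Finset.univ.filter fun b : Fin n × Fin n → D => ∀ i ∈ QA, b i = x₀ (.inl i))
      (fun x p => x (.inl p)) (m₁ := D.card ^ R * D.card ^ QB.card) (m₂ := D.card ^ QA.card)
      (t₁ := D.card ^ (n * n)) (t₂ := D.card ^ (n * n)) (by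
        intro x hx
        simp only [hS, Finset.mem_filter, Finset.mem_univ, true_and] at hx ⊢
        intro i hi
        exact hx.1 _ (by simpa [QA] using hi)) (Nat.mul_pos (hpos _) (hpos _)) (by
        intro b _
        by_cases hr : Rigid h (fun i j => (b (j, i) : F) : Matrix (Fin n) (Fin n) F)
        swap
        · rw [Finset.card_eq_zero.2, zero_mul]; · exact Nat.zero_le _
          rw [Finset.filter_eq_empty_iff]
          rintro x hx rfl
          simp only [hS, Finset.mem_filter, Finset.mem_univ, true_and] at hx
          exact hr hx.2.2.1
        have h2 := card_left_factors_mul_le D hD h (by simpa using hh) _ hr QB'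
          (fun p => x₀ (.inr p.swap)) (O₂.map (Equiv.prodComm _ _).toEmbedding) (by
            rintro ⟨j, i⟩ hp
            rw [Finset.mem_map_equiv] at hp
            simpa [O₂, hHB] using (Finset.mem_filter.1 hp).2) (fun p => y p.swap) R
            (by rw [Finset.card_map]; omega)
        rw [Fintype.card_fin, hQBc] at h2
        refine le_trans (Nat.mul_le_mul_right _ ?_) h2
        apply Finset.card_le_card_of_injOn (fun x p => x (.inr p.swap))
        · intro x hx
          simp only [hS, Finset.coe_filter, Finset.mem_filter, Finset.mem_univ, true_and,
            Set.mem_ofPred_eq] at hx ⊢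
          obtain ⟨hx, rfl⟩ := hx
          refine ⟨?_, ?_⟩
          · rintro ⟨i, j⟩ hp
            rw [hQB'] at hp
            exact hx.1 _ (by simpa [QB] using hp)
          · rintro ⟨j, i⟩ hp
            rw [Finset.mem_map_equiv] at hp
            have := hx.2.2.2 (i, j) (Finset.mem_filter.1 hp).1
            simp only [Prod.swap_prod_mk]
            rw [← this, product, Matrix.mul_apply]
            exact Finset.sum_congr rfl fun k _ => mul_comm _ _
        · intro x hx x' hx' hxx
          simp only [Finset.coe_filter, Set.mem_ofPred_eq] at hx hx'
          funext i
          rcases i with i | i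
          · exact congrFun (hx.2.trans hx'.2.symm) i
          · exact congrFun hxx i.swap) (by
        have := card_agree_mul QA (fun p => x₀ (.inl p))
        rw [Fintype.card_coe, Fintype.card_prod, Fintype.card_fin] at this
        convert this.le)
    rwa [mul_assoc, ← pow_add, ← pow_add, add_comm QB.card, hQc, pow_add] at this

end MatMul

/-! ### Rigidity of random matrices -/

namespace MatMul

variable {F : Type*} [Field F] {α : Type*} [Fintype α] [DecidableEq α]

/-- The columns `J` are independent on the rows outside `W` and span the columns `R` there. -/
def Dependent (M : Matrix α α F) (W J R : Finset α) : Prop :=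
  LinearIndependent F (fun j : J => fun u : (Finset.univ \ W : Finset α) => M u j) ∧
    ∀ r ∈ R, ∃ b : J → F, ∀ u ∈ Finset.univ \ W, M u r = ∑ j, b j * M u j

/-- W consists of the deleted rows, J is a maximal independent subset of the violating columns and R
the rest. Failure of rigidity means that J is less than half of them, hence smaller than R. -/
theorem exists_dependent_of_not_rigid {h : ℕ} {M : Matrix α α F} (hM : ¬ Rigid h M) :
    ∃ W J R : Finset α, W.card ≤ h ∧ R.card ≤ h ∧ J.card < R.card ∧ Disjoint J R ∧
      Dependent M W J R := by
  classical
  unfold Rigid at hM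
  push Not at hM
  obtain ⟨U, O, hU, hO, hUO⟩ := hM
  let v : α → (U → F) := fun j u => M u j
  obtain ⟨b, hbO, -, hsp, hli⟩ := exists_linearIndepOn_extension (K := F) (v := v)
    (s := ∅) (t := (O : Set α)) (linearIndepOn_empty _ _) (Set.empty_subset _)
  have hbf : b.Finite := O.finite_toSet.subset hbO
  obtain ⟨J, rfl⟩ := hbf.exists_finset_coe
  have hJO : J ⊆ O := by exact_mod_cast hbO
  have hli' : LinearIndependent F (fun j : J => fun u : U => M u j) := hli
  have hUW : Finset.univ \ (Finset.univ \ U) = U := by simp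
  refine ⟨Finset.univ \ U, J, O \ J, ?_, ?_, ?_, Finset.disjoint_sdiff, ?_, ?_⟩
  · rw [Finset.card_sdiff_of_subset (Finset.subset_univ _), Finset.card_univ]; omega
  · exact (Finset.card_le_card Finset.sdiff_subset).trans hO
  · rw [Finset.card_sdiff_of_subset hJO]
    by_contra hc
    exact hUO J hJO (by omega) hli'
  · rw [hUW]; exact hli'
  · rw [hUW]
    intro r hr
    have := hsp ⟨r, by exact_mod_cast (Finset.mem_sdiff.1 hr).1, rfl⟩
    rw [Set.image_eq_range] at this
    obtain ⟨c, hc⟩ := (Submodule.mem_span_range_iff_exists_fun F).1 this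
    refine ⟨c, fun u hu => ?_⟩
    have := congrFun hc ⟨u, hu⟩
    simp only [Finset.sum_apply, Pi.smul_apply, smul_eq_mul, v] at this
    exact this.symm

-- The columns outside R, among them those of J, are free. A column in R lies outside W in the span
-- of J, so it has at most d^(|W| + |J|) ≤ d^(2h) values instead of d^n.
open scoped Classical in
theorem card_dependent_mul_le (D : Finset F) (hD : 1 ≤ D.card) (h : ℕ)
    (W J R : Finset α) (hW : W.card ≤ h) (hR : R.card ≤ h) (hJR : J.card < R.card)
    (hdis : Disjoint J R) (e : ℕ) (he : 2 * e + 2 * h ≤ Fintype.card α) :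
    (Finset.univ.filter fun a : α × α → D =>
        Dependent (fun i j => (a (i, j) : F) : Matrix α α F) W J R).card
      * D.card ^ (2 * e * R.card) ≤ D.card ^ (Fintype.card α * Fintype.card α) := by
  set S := Finset.univ.filter fun a : α × α → D =>
        Dependent (fun i j => (a (i, j) : F) : Matrix α α F) W J R with hS
  have hmain := card_mul_le_of_fibers S
    (Finset.univ : Finset ({j // j ∉ R} → α → D)) (fun a j i => a (i, j.1))
    (m₁ := 1) (m₂ := 1) (t₁ := D.card ^ (2 * h * R.card))
    (t₂ := D.card ^ (Fintype.card α * (Fintype.card α - R.card))) (by simp) one_pos (by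
      intro b _
      rw [mul_one]
      rcases (S.filter fun a => (fun (j : {j // j ∉ R}) i => a (i, j.1)) = b).eq_empty_or_nonempty
        with h0 | ⟨a₀, ha₀⟩
      · rw [h0]; simp
      · rw [Finset.mem_filter] at ha₀
        obtain ⟨ha₀, rfl⟩ := ha₀
        simp only [hS, Finset.mem_filter, Finset.mem_univ, true_and] at ha₀
        have hc := card_span_mul_le D (fun i j => (a₀ (i, j) : F) : Matrix α α F) _ J ha₀.1
        have hle : (D.card ^ ((Finset.univ \ (Finset.univ \ W)).card + J.card)) ^ R.card
            ≤ D.card ^ (2 * h * R.card) := by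
          rw [← pow_mul]
          apply Nat.pow_le_pow_right hD
          apply Nat.mul_le_mul_right
          rw [Finset.sdiff_sdiff_eq_self (Finset.subset_univ _)]
          omega
        refine le_trans ?_ hle
        refine le_trans ?_ (Nat.pow_le_pow_left hc R.card)
        have hpi := Fintype.card_piFinset (fun _ : R => Finset.univ.filter fun a : α → D =>
          ∃ b : J → F, ∀ u ∈ Finset.univ \ W, (a u : F) = ∑ j, b j * (a₀ (u, j.1) : F))
        rw [Finset.prod_const, Finset.card_univ, Fintype.card_coe] at hpi
        rw [← hpi]
        apply Finset.card_le_card_of_injOn (fun a r i => a (i, r.1))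
        · intro a ha
          rw [Finset.mem_coe, Finset.mem_filter] at ha
          obtain ⟨ha, hab⟩ := ha
          simp only [hS, Finset.mem_filter, Finset.mem_univ, true_and] at ha
          rw [Finset.mem_coe, Fintype.mem_piFinset]
          intro r
          rw [Finset.mem_filter]
          refine ⟨Finset.mem_univ _, ?_⟩
          obtain ⟨c, hc⟩ := ha.2 r r.2
          refine ⟨c, fun u hu => ?_⟩
          refine (hc u hu).trans ?_
          refine Finset.sum_congr rfl fun j _ => ?_
          have := congrFun (congrFun hab ⟨j, Finset.disjoint_left.1 hdis j.2⟩) u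
          exact congrArg (fun t : D => c j * (t : F)) this
        · intro a ha a' ha' haa
          rw [Finset.mem_coe, Finset.mem_filter] at ha ha'
          funext p
          by_cases hp : p.2 ∈ R
          · exact congrFun (congrFun haa ⟨p.2, hp⟩) p.1
          · exact congrFun (congrFun (ha.2.trans ha'.2.symm) ⟨p.2, hp⟩) p.1) (by
      rw [mul_one, Finset.card_univ, Fintype.card_fun, Fintype.card_fun, Fintype.card_coe,
        ← pow_mul, Fintype.card_subtype_compl, Fintype.card_coe])
  rw [mul_one, mul_one] at hmain
  calc _ ≤ D.card ^ (2 * h * R.card) * D.card ^ (Fintype.card α * (Fintype.card α - R.card))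
          * D.card ^ (2 * e * R.card) := Nat.mul_le_mul_right _ hmain
    _ = D.card ^ ((2 * e + 2 * h) * R.card + Fintype.card α * (Fintype.card α - R.card)) := by
        rw [← pow_add, ← pow_add]; congr 1; ring
    _ ≤ _ := by
        apply Nat.pow_le_pow_right hD
        calc _ ≤ Fintype.card α * R.card + Fintype.card α * (Fintype.card α - R.card) := by gcongr
          _ = Fintype.card α * Fintype.card α := by
            rw [← mul_add, Nat.add_sub_cancel' (Finset.card_le_univ R)]

-- Union bound over the triples (W, J, R), with the size constraints replaced by weights: 16^(h -
-- |W|) ≥ 1, and d^(-2e|R|) ≤ z^(2|R|) ≤ z^(|J| + |R|) because |J| < |R|. The weights can be summed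
-- over all triples by the binomial theorem; the factor with -1 reflects R ≠ ∅ and makes the bound
-- small.
open scoped Classical in
theorem card_not_rigid_le (D : Finset F) (hD : 2 ≤ D.card) (h e : ℕ)
    (he : 2 * e + 2 * h ≤ Fintype.card α) (z : ℝ) (hz : z = (1 / 2) ^ e) :
    ((Finset.univ.filter fun a : α × α → D =>
        ¬ Rigid h (fun i j => (a (i, j) : F) : Matrix α α F)).card : ℝ)
      ≤ (D.card : ℝ) ^ (Fintype.card α * Fintype.card α) *
        ((16 ^ h * (17 / 16) ^ Fintype.card α) * ((1 + z) ^ Fintype.card α *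
          ((1 + z) ^ Fintype.card α - 1))) := by
  have hz0 : 0 < z := by rw [hz]; positivity
  have hz1 : z ≤ 1 := by rw [hz]; exact pow_le_one₀ (by norm_num) (by norm_num)
  have hgf : ∀ t : ℝ, ∑ s : Finset α, t ^ s.card = (t + 1) ^ Fintype.card α := by
    intro t
    simpa using Fintype.sum_pow_mul_eq_add_pow α t 1
  let I : Finset (Finset α × Finset α × Finset α) := Finset.univ.filter fun t =>
    t.1.card ≤ h ∧ t.2.2.card ≤ h ∧ t.2.1.card < t.2.2.card ∧ Disjoint t.2.1 t.2.2
  let S : Finset α × Finset α × Finset α → Finset (α × α → D) := fun t =>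
    Finset.univ.filter fun a => Dependent (fun i j => (a (i, j) : F) : Matrix α α F) t.1 t.2.1 t.2.2
  let w : Finset α × Finset α × Finset α → ℝ := fun t =>
    (16 ^ h * (1 / 16) ^ t.1.card) * (z ^ t.2.1.card * (if t.2.2 = ∅ then 0 else z ^ t.2.2.card))
  have hd : (0 : ℝ) < D.card := by exact_mod_cast (by omega : 0 < D.card)
  have hbound : ∀ t ∈ I, ((S t).card : ℝ) ≤ (D.card : ℝ) ^ (Fintype.card α * Fintype.card α) * w t := by
    rintro ⟨W, J, R⟩ ht
    simp only [I, Finset.mem_filter, Finset.mem_univ, true_and] at ht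
    obtain ⟨hW, hR, hJR, hdis⟩ := ht
    have h1 := card_dependent_mul_le D (by omega) h W J R hW hR hJR hdis e he
    have h2 : ((S (W, J, R)).card : ℝ) * (D.card : ℝ) ^ (2 * e * R.card)
        ≤ (D.card : ℝ) ^ (Fintype.card α * Fintype.card α) := by exact_mod_cast h1
    have hRne : R ≠ ∅ := by rintro rfl; simp at hJR
    have h3 : (1 : ℝ) ≤ 16 ^ h * (1 / 16) ^ W.card := by
      rw [one_div, inv_pow, ← div_eq_mul_inv, one_le_div (by positivity)]
      exact pow_le_pow_right₀ (by norm_num) hW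
    have h4 : 1 ≤ z ^ (J.card + R.card) * (D.card : ℝ) ^ (2 * e * R.card) := by
      have h5 : (2 : ℝ) ^ (2 * e * R.card) ≤ (D.card : ℝ) ^ (2 * e * R.card) := by
        gcongr; exact_mod_cast hD
      have h6 : z ^ (2 * R.card) ≤ z ^ (J.card + R.card) :=
        pow_le_pow_of_le_one hz0.le hz1 (by omega)
      calc (1 : ℝ) = z ^ (2 * R.card) * 2 ^ (2 * e * R.card) := by
            rw [hz, ← pow_mul, show e * (2 * R.card) = 2 * e * R.card by ring, ← mul_pow]; norm_num
        _ ≤ _ := by gcongr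
    simp only [w, if_neg hRne]
    rw [← pow_add]
    calc ((S (W, J, R)).card : ℝ) = ((S (W, J, R)).card : ℝ) * 1 := (mul_one _).symm
      _ ≤ (S (W, J, R)).card * (z ^ (J.card + R.card) * (D.card : ℝ) ^ (2 * e * R.card)) := by gcongr
      _ = ((S (W, J, R)).card * (D.card : ℝ) ^ (2 * e * R.card)) * (1 * z ^ (J.card + R.card)) := by ring
      _ ≤ _ := by gcongr
  have hsub : (Finset.univ.filter fun a : α × α → D =>
        ¬ Rigid h (fun i j => (a (i, j) : F) : Matrix α α F)) ⊆ I.biUnion S := by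
    intro a ha
    rw [Finset.mem_filter] at ha
    obtain ⟨W, J, R, h1, h2, h3, h4, h5⟩ := exists_dependent_of_not_rigid ha.2
    rw [Finset.mem_biUnion]
    exact ⟨(W, J, R), by simp [I, h1, h2, h3, h4], by simpa [S] using h5⟩
  have hw0 : ∀ t, 0 ≤ w t := by
    intro t
    simp only [w]
    split_ifs <;> positivity
  calc _ ≤ ((I.biUnion S).card : ℝ) := by exact_mod_cast Finset.card_le_card hsub
    _ ≤ ∑ t ∈ I, ((S t).card : ℝ) := by exact_mod_cast Finset.card_biUnion_le
    _ ≤ ∑ t ∈ I, (D.card : ℝ) ^ (Fintype.card α * Fintype.card α) * w t := Finset.sum_le_sum hbound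
    _ ≤ ∑ t, (D.card : ℝ) ^ (Fintype.card α * Fintype.card α) * w t :=
        Finset.sum_le_sum_of_subset_of_nonneg (Finset.subset_univ _)
          fun t _ _ => mul_nonneg (by positivity) (hw0 t)
    _ = _ := by
      rw [← Finset.mul_sum]
      congr 1
      simp only [w, Fintype.sum_prod_type, ← Finset.mul_sum, ← Finset.sum_mul]
      congr 1
      · rw [hgf]; norm_num
      · rw [hgf]
        congr 1
        · rw [add_comm]
        · have : ∀ s : Finset α, (if s = ∅ then 0 else z ^ s.card)
              = z ^ s.card - if s = ∅ then 1 else 0 := by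
            intro s; split_ifs with h <;> simp [h]
          simp only [this, Finset.sum_sub_distrib, hgf]
          simp [add_comm]

/-- All but a superpolynomially small fraction of the matrices over `D` are rigid. -/
theorem exists_card_not_rigid_le (C : ℕ) : ∃ n₀ : ℕ, ∀ n ≥ n₀,
    ∀ (F : Type u) [Field F] [DecidableEq F] (D : Finset F), 2 ≤ D.card →
      (Nat.card {a : Fin n × Fin n → D //
        ¬ Rigid (2 * (n / 128)) (fun i j => (a (i, j) : F) : Matrix (Fin n) (Fin n) F)} : ℝ)
        ≤ (D.card : ℝ) ^ (n * n) / (8 * n ^ C) := by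
  have hlim := tendsto_pow_const_mul_const_pow_of_abs_lt_one (C + 1) (r := (1 / 256 : ℝ))
    (by rw [abs_of_pos] <;> norm_num)
  have hev := hlim.eventually_lt_const
    (u := 1 / (8 * 6 * 2 ^ 16 * 256 ^ (C + 1))) (by positivity)
  obtain ⟨m₀, hm₀⟩ := Filter.eventually_atTop.1 hev
  refine ⟨128 * (m₀ + 1), ?_⟩
  intro n hn F _ _ D hD
  classical
  obtain ⟨m, hm⟩ : ∃ m, m = n / 128 := ⟨_, rfl⟩
  rw [← hm]
  have hmm : m₀ + 1 ≤ m := by omega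
  have hnm : n ≤ 256 * m := by omega
  have hnm' : n ≤ 128 * m + 128 := by omega
  have hz : ((1 : ℝ) / 2) ^ (32 * m) = (1 / 2) ^ (32 * m) := rfl
  -- With e = 32m, z is 2^(-24m) · 256^(-m). The first factor pays for 16^(2m) (17/16)^n ≤ 2^(24m +
  -- 16); the second beats every power of n.
  have hmain := card_not_rigid_le (α := Fin n) D hD (2 * m) (32 * m)
    (by rw [Fintype.card_fin]; omega) _ hz
  rw [Fintype.card_fin] at hmain
  rw [Nat.card_eq_fintype_card, Fintype.card_subtype]
  refine hmain.trans ?_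
  rw [div_eq_mul_inv]
  apply mul_le_mul_of_nonneg_left _ (by positivity)
  set z : ℝ := (1 / 2) ^ (32 * m) with hzdef
  have hz0 : 0 < z := by positivity
  have hlt := hm₀ m (by omega)
  have hn1 : (1 : ℝ) ≤ n := by exact_mod_cast (by omega : 1 ≤ n)
  have hnC : (n : ℝ) ^ (C + 1) * (1 / 256) ^ m ≤ 1 / (8 * 6 * 2 ^ 16) := by
    calc (n : ℝ) ^ (C + 1) * (1 / 256) ^ m ≤ (256 * m) ^ (C + 1) * (1 / 256) ^ m := by
          gcongr; exact_mod_cast hnm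
      _ = 256 ^ (C + 1) * ((m : ℝ) ^ (C + 1) * (1 / 256) ^ m) := by rw [mul_pow]; ring
      _ ≤ 256 ^ (C + 1) * (1 / (8 * 6 * 2 ^ 16 * 256 ^ (C + 1))) := by gcongr
      _ = _ := by field_simp
  have hzz : z = (1 / 256) ^ m * (1 / 2 ^ 24) ^ m := by
    rw [hzdef, pow_mul, ← mul_pow]; norm_num
  have hn1C : (n : ℝ) ≤ n ^ (C + 1) := by
    rw [pow_succ]; exact le_mul_of_one_le_left (by positivity) (one_le_pow₀ hn1)
  have hsmall : ((1 : ℝ) / 2 ^ 24) ^ m ≤ 1 := pow_le_one₀ (by norm_num) (by norm_num)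
  have hnz : n * z ≤ 1 := by
    calc (n : ℝ) * z ≤ n ^ (C + 1) * ((1 / 256) ^ m * 1) := by rw [hzz]; gcongr
      _ ≤ 1 / (8 * 6 * 2 ^ 16) := by rw [mul_one]; exact hnC
      _ ≤ 1 := by norm_num
  have hpow : (1 + z) ^ n ≤ 1 + 2 * (n * z) := by
    have h1 : (1 + z) ^ n ≤ Real.exp (n * z) := by
      rw [Real.exp_nat_mul]
      gcongr
      rw [add_comm]; exact Real.add_one_le_exp z
    have h2 := Real.abs_exp_sub_one_le (x := n * z) (by rw [abs_of_nonneg (by positivity)]; exact hnz)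
    rw [abs_of_nonneg (by positivity : (0 : ℝ) ≤ n * z)] at h2
    have := (abs_le.1 h2).2
    linarith
  have h17 : ((17 : ℝ) / 16) ^ n ≤ 2 ^ 16 * (2 ^ 16) ^ m := by
    calc ((17 : ℝ) / 16) ^ n ≤ (17 / 16) ^ (128 * m + 128) :=
          pow_le_pow_right₀ (by norm_num) hnm'
      _ = ((17 / 16) ^ 8) ^ (16 * m + 16) := by rw [← pow_mul]; congr 1; ring
      _ ≤ 2 ^ (16 * m + 16) := by gcongr; norm_num
      _ = _ := by rw [pow_add, pow_mul]; ring
  have h1z : (0 : ℝ) ≤ (1 + z) ^ n - 1 := by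
    have : (1 : ℝ) ≤ (1 + z) ^ n := one_le_pow₀ (by linarith)
    linarith
  have hfin : (16 : ℝ) ^ (2 * m) * (17 / 16) ^ n * ((1 + z) ^ n * ((1 + z) ^ n - 1))
      ≤ 6 * 2 ^ 16 * (n * (1 / 256) ^ m) := by
    calc (16 : ℝ) ^ (2 * m) * (17 / 16) ^ n * ((1 + z) ^ n * ((1 + z) ^ n - 1))
        ≤ 16 ^ (2 * m) * (2 ^ 16 * (2 ^ 16) ^ m) * (3 * (2 * (n * z))) := by
          gcongr
          · linarith
          · linarith
      _ = 6 * 2 ^ 16 * (n * (1 / 256) ^ m) * ((16 ^ 2) * 2 ^ 16 * (1 / 2 ^ 24)) ^ m := by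
          rw [hzz, mul_pow, mul_pow, pow_mul 16 2 m]; ring
      _ = _ := by norm_num
  refine hfin.trans ?_
  rw [mul_inv, ← one_div, ← one_div]
  have h8 : n ^ C * (n * (1 / 256 : ℝ) ^ m) ≤ 1 / (8 * 6 * 2 ^ 16) := by
    rw [← mul_assoc, ← pow_succ]; exact hnC
  have : (n * (1 / 256 : ℝ) ^ m) ≤ 1 / (8 * 6 * 2 ^ 16) * (1 / n ^ C) := by
    rw [mul_one_div, le_div_iff₀ (by positivity), mul_comm]; exact h8
  calc _ ≤ 6 * 2 ^ 16 * (1 / (8 * 6 * 2 ^ 16) * (1 / (n : ℝ) ^ C)) := by gcongr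
    _ = _ := by ring

end MatMul

/-! ### Query machines -/

/-- A deterministic device reading its input one coordinate at a time: one step and the statements
output in it depend only on the state and on the value of the queried coordinate. -/
structure QueryMachine (ι κ D R : Type*) where
  State : Type
  query : State → Option ι
  step : State → (ι → D) → State
  emit : State → (ι → D) → Set (κ × R)
  step_congr : ∀ v x y, (∀ i ∈ query v, x i = y i) → step v x = step v y
  emit_congr : ∀ v x y, (∀ i ∈ query v, x i = y i) → emit v x = emit v y

namespace QueryMachine

variable {ι κ D R : Type*} (P : QueryMachine ι κ D R)

/-- The state after `t` steps. -/
def run (v : P.State) (x : ι → D) (t : ℕ) : P.State := (fun w => P.step w x)^[t] v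

theorem run_add (v : P.State) (x : ι → D) (s t : ℕ) :
    P.run v x (s + t) = P.run (P.run v x s) x t := by
  unfold run
  rw [add_comm, Function.iterate_add_apply]

/-- The coordinates queried in the first `q` steps. -/
def queried [DecidableEq ι] (v : P.State) (x : ι → D) (q : ℕ) : Finset ι :=
  (Finset.range q).biUnion fun t => (P.query (P.run v x t)).toFinset

/-- The statements output in the first `q` steps. -/
def emitted (v : P.State) (x : ι → D) (q : ℕ) : Set (κ × R) :=
  {e | ∃ t < q, e ∈ P.emit (P.run v x t) x}

theorem emitted_add_subset (v : P.State) (x : ι → D) (s q : ℕ) :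
    P.emitted v x (s + q) ⊆ P.emitted v x s ∪ P.emitted (P.run v x s) x q := by
  rintro e ⟨t, ht, he⟩
  by_cases hts : t < s
  · exact Or.inl ⟨t, hts, he⟩
  · refine Or.inr ⟨t - s, by omega, ?_⟩
    rwa [← P.run_add, Nat.add_sub_cancel' (by omega)]

theorem emitted_mono (v : P.State) (x : ι → D) {q q' : ℕ} (h : q ≤ q') :
    P.emitted v x q ⊆ P.emitted v x q' :=
  fun _ ⟨t, ht, he⟩ => ⟨t, by omega, he⟩

variable [DecidableEq ι]

theorem card_queried_le (v : P.State) (x : ι → D) (q : ℕ) : (P.queried v x q).card ≤ q := by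
  refine (Finset.card_biUnion_le_card_mul _ _ 1 fun t _ => ?_).trans (by simp)
  cases P.query (P.run v x t) <;> simp

-- While two runs coincide, they query the same coordinate, on which the inputs agree. So the
-- coordinates queried on x, with their values, form a certificate for the run, like a leaf of a
-- decision tree.
variable {P} in
theorem run_congr {v : P.State} {x y : ι → D} {q : ℕ}
    (h : ∀ i ∈ P.queried v x q, y i = x i) : ∀ t ≤ q, P.run v y t = P.run v x t := by
  intro t
  induction t with
  | zero => intro _; rfl
  | succ t ih =>
    intro ht
    rw [P.run_add, P.run_add, ih (by omega)]
    refine P.step_congr _ _ _ fun i hi => h i ?_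
    exact Finset.mem_biUnion.2 ⟨t, Finset.mem_range.2 (by omega), by simpa using hi⟩

variable {P} in
theorem queried_congr {v : P.State} {x y : ι → D} {q : ℕ}
    (h : ∀ i ∈ P.queried v x q, y i = x i) : P.queried v y q = P.queried v x q := by
  unfold queried
  refine Finset.biUnion_congr rfl fun t ht => ?_
  rw [run_congr h t (Finset.mem_range.1 ht).le]

variable {P} in
theorem emitted_congr {v : P.State} {x y : ι → D} {q : ℕ}
    (h : ∀ i ∈ P.queried v x q, y i = x i) : P.emitted v y q = P.emitted v x q := by
  unfold emitted
  ext e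
  refine exists_congr fun t => and_congr_right fun ht => ?_
  rw [run_congr h t ht.le, P.emit_congr _ y x]
  intro i hi
  exact h i (Finset.mem_biUnion.2 ⟨t, Finset.mem_range.2 ht, by simpa using hi⟩)

end QueryMachine

/-! ### Correct outputs within a short block -/

namespace MatMul

variable {F : Type*} [Field F] {n : ℕ}

/-- Both matrices are rigid; for the first one this refers to its rows. -/
def RigidPair {D : Finset F} (h : ℕ) (x : Idx n → D) : Prop :=
  Rigid h (right x) ∧ Rigid h (left x).transpose

/-- From the state `v`, at least `k` entries are output within `q` steps, all of them correctly. -/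
def Advances {D : Finset F} (P : QueryMachine (Idx n) (Fin n × Fin n) D F) (v : P.State)
    (q k : ℕ) (x : Idx n → D) : Prop :=
  (∀ e ∈ P.emitted v x q, e.2 = product x e.1) ∧ k ≤ (Prod.fst '' P.emitted v x q).ncard

-- Inputs are classified by the set of coordinates queried within q steps together with the values
-- found. A class consists of all inputs agreeing with x₀ on Q, and the statements output are
-- constant on it. By `card_correct_mul_le`, a fraction of at most d^(-R) of each class is rigid and
-- advances.
open scoped Classical in
theorem card_advances_mul_le (D : Finset F) (hD : 1 ≤ D.card) (h : ℕ) (hh : n ≤ 128 * h)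
    (P : QueryMachine (Idx n) (Fin n × Fin n) D F) (v : P.State) (q k R : ℕ)
    (hq : q ^ 2 ≤ h ^ 2 * k) (hR : 1024 * R < k + 1024) :
    (Finset.univ.filter fun x : Idx n → D => RigidPair h x ∧ Advances P v q k x).card * D.card ^ R
      ≤ D.card ^ (n * n) * D.card ^ (n * n) := by
  set S := Finset.univ.filter fun x : Idx n → D => RigidPair h x ∧ Advances P v q k x with hS
  let f : (Idx n → D) → (Idx n → Option D) := fun x i =>
    if i ∈ P.queried v x q then some (x i) else none
  have hf : ∀ x y, f y = f x ↔ ∀ i ∈ P.queried v x q, y i = x i := by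
    intro x y
    constructor
    · intro hxy i hi
      have := congrFun hxy i
      simp only [f, if_pos hi] at this
      split_ifs at this
      simpa using this
    · intro hxy
      funext i
      simp only [f, QueryMachine.queried_congr hxy]
      split_ifs with hi
      · rw [hxy i hi]
      · rfl
  have hX : (Finset.univ : Finset (Idx n → D)).card = D.card ^ (n * n) * D.card ^ (n * n) := by
    rw [Finset.card_univ, Fintype.card_fun, Fintype.card_coe, Fintype.card_sum, Fintype.card_prod,
      Fintype.card_fin, pow_add]
  rw [← hX]
  rw [Finset.card_eq_sum_card_fiberwise (s := S) (f := f) (t := Finset.univ) (by intro; simp),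
    Finset.card_eq_sum_card_fiberwise (s := Finset.univ) (f := f) (t := Finset.univ)
      (by intro; simp), Finset.sum_mul]
  refine Finset.sum_le_sum fun b _ => ?_
  rcases (S.filter fun x => f x = b).eq_empty_or_nonempty with h0 | ⟨x₀, hx₀⟩
  · rw [h0]; simp
  rw [Finset.mem_filter] at hx₀
  obtain ⟨hx₀, rfl⟩ := hx₀
  simp only [hS, Finset.mem_filter, Finset.mem_univ, true_and] at hx₀
  obtain ⟨-, hcor, hk⟩ := hx₀
  simp only [hf]
  set Q := P.queried v x₀ q with hQdef
  let O : Finset (Fin n × Fin n) := (Prod.fst '' P.emitted v x₀ q).toFinset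
  have hkO : k ≤ O.card := by rwa [← Set.ncard_eq_toFinset_card']
  have hQ : Q.card ^ 2 ≤ h ^ 2 * k := (Nat.pow_le_pow_left (P.card_queried_le v x₀ q) 2).trans hq
  have h1 := card_correct_mul_le D hD h hh Q x₀ O (product x₀) k R hkO hQ hR
  have h2 := card_agree_mul Q x₀
  rw [Fintype.card_coe, Fintype.card_sum, Fintype.card_prod, Fintype.card_fin, pow_add] at h2
  have hpos : 0 < D.card ^ Q.card := Nat.pow_pos hD
  refine Nat.le_of_mul_le_mul_right ?_ hpos
  rw [mul_assoc]
  have h3 : (Finset.univ.filter fun x : Idx n → D => ∀ i ∈ Q, x i = x₀ i).card * D.card ^ Q.card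
      = D.card ^ (n * n) * D.card ^ (n * n) := by convert h2
  rw [h3]
  refine le_trans (Nat.mul_le_mul_right _ (Finset.card_le_card ?_)) h1
  intro x hx
  simp only [hS, Finset.mem_filter, Finset.mem_univ, true_and] at hx ⊢
  refine ⟨hx.2, hx.1.1.1, hx.1.1.2, ?_⟩
  intro p hp
  obtain ⟨e, he, rfl⟩ := Set.mem_toFinset.1 hp
  rw [← hcor e he, ← hx.1.2.1 e (by rwa [QueryMachine.emitted_congr hx.2])]

end MatMul

/-! ### Decomposition of time into blocks -/

/-- Cauchy–Schwarz for two terms, in the form that preserves B² ≤ AC while blocks are added. -/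
theorem add_sq_le_add_mul_add {A B C a b c : ℝ} (hA : 0 ≤ A) (hC : 0 ≤ C)
    (ha : 0 ≤ a) (hc : 0 ≤ c) (h : B ^ 2 ≤ A * C) (h' : b ^ 2 ≤ a * c) :
    (B + b) ^ 2 ≤ (A + a) * (C + c) := by
  have h1 : (2 * (B * b)) ^ 2 ≤ (A * c + a * C) ^ 2 := by
    have : B ^ 2 * b ^ 2 ≤ (A * C) * (a * c) := mul_le_mul h h' (sq_nonneg _) (by positivity)
    nlinarith [sq_nonneg (A * c - a * C)]
  have h2 : 2 * (B * b) ≤ A * c + a * C := le_of_abs_le (abs_le_of_sq_le_sq h1 (by positivity))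
  nlinarith

/-- Backward greedy decomposition of a time interval into blocks, the `i`-th kind of which has length
between `2 ^ i * w` and `2 ^ (i + 1) * w`, starts at cost at most `4 ^ i * Λ` and, for `1 ≤ i`,
contains a proportional amount of cost. -/
theorem exists_block_decomposition (g : ℕ → ℝ) (hg : ∀ t, 0 ≤ g t) (Λ : ℝ) (hΛ : 0 < Λ)
    (hg0 : g 0 ≤ Λ) (w κ τ : ℕ) (hw : 1 ≤ w) (hκ : 1 ≤ κ) (N : ℕ → ℕ) (hN0 : N 0 = 0)
    (hN : ∀ s e i, s < e → e ≤ τ → e ≤ s + 2 ^ (i + 1) * w → g s ≤ 4 ^ i * Λ →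
      N e + 1 ≤ N s + κ * 4 ^ i) :
    ∀ e ≤ τ, ∃ (m : ℕ) (A B C : ℝ), 0 ≤ A ∧ 0 ≤ B ∧ 0 ≤ C ∧ B ^ 2 ≤ A * C ∧
      (N e : ℝ) ≤ m * (κ - 1) + κ * B ∧ m * w ≤ e + w ∧ A * w ≤ e ∧
      w * Λ * C ≤ 8 * ∑ t ∈ Finset.range e, g t := by
  intro e
  induction e using Nat.strong_induction_on with
  | _ e ih =>
  intro he
  have hκ' : (1 : ℝ) ≤ κ := by exact_mod_cast hκ
  have hsum0 : ∀ s : Finset ℕ, 0 ≤ ∑ t ∈ s, g t := fun s => Finset.sum_nonneg fun t _ => hg t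
  rcases Nat.eq_zero_or_pos e with rfl | hepos
  · exact ⟨0, 0, 0, 0, le_rfl, le_rfl, le_rfl, by simp, by simp [hN0], by simp, by simp, by simp⟩
  by_cases hew : e ≤ w
  -- The earliest block may be shorter than w; it accounts for the extra w in `m * w ≤ e + w`.
  · refine ⟨1, 0, 0, 0, le_rfl, le_rfl, le_rfl, by simp, ?_, by omega, by simp, ?_⟩
    · have := hN 0 e 0 hepos he (by simp; omega) (by simpa using hg0)
      rw [hN0] at this
      have h2 : (N e : ℝ) + 1 ≤ κ := by exact_mod_cast (by omega : N e + 1 ≤ κ)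
      simp; linarith
    · simp only [mul_zero]
      exact mul_nonneg (by norm_num) (hsum0 _)
  push Not at hew
  -- Time 0 is always an admissible start, because its cost is at most Λ; the kind is the first
  -- scale that reaches back to it.
  have hex : ∃ i s, s + 2 ^ i * w < e ∧ e ≤ s + 2 ^ (i + 1) * w ∧ g s ≤ 4 ^ i * Λ := by
    have hex' : ∃ i, e ≤ 2 ^ (i + 1) * w := by
      refine ⟨e, ?_⟩
      have : e < 2 ^ (e + 1) := (Nat.lt_succ_self e).trans Nat.lt_two_pow_self
      nlinarith
    classical
    refine ⟨Nat.find hex', 0, ?_, by simpa using Nat.find_spec hex', ?_⟩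
    · rcases h : Nat.find hex' with _ | j
      · simpa using hew
      · have := Nat.find_min hex' (m := j) (by omega)
        omega
    · refine hg0.trans (le_mul_of_one_le_left hΛ.le (one_le_pow₀ (by norm_num)))
  classical
  obtain ⟨s, hs1, hs2, hs3⟩ := Nat.find_spec hex
  have hmin := fun j (hj : j < Nat.find hex) => Nat.find_min hex hj
  generalize Nat.find hex = i at hs1 hs2 hs3 hmin
  have hse : s < e := by omega
  obtain ⟨m, A, B, C, hA, hB, hC, hBAC, h1, h2, h3, h4⟩ := ih s hse (by omega)
  have hblock := hN s e i hse he hs2 hs3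
  have hblock' : (N e : ℝ) + 1 ≤ N s + κ * 4 ^ i := by exact_mod_cast hblock
  rcases i with _ | j
  · refine ⟨m + 1, A, B, C, hA, hB, hC, hBAC, ?_, ?_, ?_, ?_⟩
    · push_cast; simp at hblock'; linarith
    · simp at hs1; rw [add_mul]; omega
    · exact h3.trans (by exact_mod_cast hse.le)
    · refine h4.trans ?_
      gcongr
      intro t _ _; exact hg t
  -- A, B, C collect, over the blocks of kind at least 1, length in units of w, outputs in units of
  -- κ, and cost in units of wΛ/8.
  · refine ⟨m, A + 2 ^ (j + 1), B + 4 ^ (j + 1), C + 8 ^ (j + 1), by positivity, by positivity,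
      by positivity, ?_, ?_, by omega, ?_, ?_⟩
    · refine add_sq_le_add_mul_add hA hC (by positivity) (by positivity) hBAC (le_of_eq ?_)
      rw [← mul_pow, ← pow_mul, mul_comm, pow_mul]; norm_num
    · linarith
    · have : (s : ℝ) + 2 ^ (j + 1) * w ≤ e := by exact_mod_cast hs1.le
      linarith
    · have hlow : ∀ t ∈ Finset.Ico (e - 2 ^ (j + 1) * w) (e - 2 ^ j * w), 4 ^ j * Λ ≤ g t := by
        intro t ht
        rw [Finset.mem_Ico] at ht
        by_contra hlt
        exact hmin j (by omega) ⟨t, by omega, by omega, (not_le.1 hlt).le⟩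
      have hsum := Finset.card_nsmul_le_sum _ _ _ hlow
      have hpw : 2 ^ (j + 1) * w = 2 ^ j * w + 2 ^ j * w := by ring
      rw [Nat.card_Ico, show e - 2 ^ j * w - (e - 2 ^ (j + 1) * w) = 2 ^ j * w by omega,
        nsmul_eq_mul] at hsum
      have hsub : Finset.range s ∪ Finset.Ico (e - 2 ^ (j + 1) * w) (e - 2 ^ j * w)
          ⊆ Finset.range e := by
        intro t ht
        simp only [Finset.mem_union, Finset.mem_range, Finset.mem_Ico] at ht ⊢
        omega
      have hdis : Disjoint (Finset.range s)
          (Finset.Ico (e - 2 ^ (j + 1) * w) (e - 2 ^ j * w)) := by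
        rw [Finset.disjoint_left]
        intro t ht
        simp only [Finset.mem_range, Finset.mem_Ico] at ht ⊢
        omega
      have htot := Finset.sum_le_sum_of_subset_of_nonneg hsub (f := g) (fun t _ _ => hg t)
      rw [Finset.sum_union hdis] at htot
      have h8 : (8 : ℝ) ^ (j + 1) = 8 * (2 ^ j * 4 ^ j) := by
        rw [← mul_pow, pow_succ]; norm_num; ring
      push_cast at hsum
      rw [h8]
      nlinarith

/-- If the blocks of the lowest kind account for at most half of the outputs, then the cumulative
cost is large. -/
theorem sq_mul_le_cumulative (g : ℕ → ℝ) (hg : ∀ t, 0 ≤ g t) (Λ : ℝ) (hΛ : 0 < Λ)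
    (hg0 : g 0 ≤ Λ) (w κ τ : ℕ) (hw : 1 ≤ w) (hκ : 1 ≤ κ) (N : ℕ → ℕ) (hN0 : N 0 = 0)
    (hN : ∀ s e i, s < e → e ≤ τ → e ≤ s + 2 ^ (i + 1) * w → g s ≤ 4 ^ i * Λ →
      N e + 1 ≤ N s + κ * 4 ^ i)
    (hbase : (τ + w) * ((κ : ℝ) - 1) ≤ w * N τ / 2) :
    (N τ : ℝ) ^ 2 * w ^ 2 * Λ ≤ 32 * κ ^ 2 * (τ * ∑ t ∈ Finset.range τ, g t) := by
  obtain ⟨m, A, B, C, hA, hB, hC, hBAC, h1, h2, h3, h4⟩ :=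
    exists_block_decomposition g hg Λ hΛ hg0 w κ τ hw hκ N hN0 hN τ le_rfl
  have hw' : (0 : ℝ) < w := by exact_mod_cast hw
  have hκ' : (1 : ℝ) ≤ κ := by exact_mod_cast hκ
  have h2' : (m : ℝ) * w ≤ τ + w := by exact_mod_cast h2
  have h5 : w * (m * ((κ : ℝ) - 1)) ≤ w * (N τ / 2) := by
    calc w * (m * ((κ : ℝ) - 1)) = (m * w) * (κ - 1) := by ring
      _ ≤ (τ + w) * (κ - 1) := mul_le_mul_of_nonneg_right h2' (by linarith)
      _ ≤ _ := by linarith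
  have h6 : (m : ℝ) * (κ - 1) ≤ N τ / 2 := le_of_mul_le_mul_left h5 hw'
  have h7 : (N τ : ℝ) ≤ 2 * (κ * B) := by linarith
  calc (N τ : ℝ) ^ 2 * w ^ 2 * Λ ≤ (2 * (κ * B)) ^ 2 * w ^ 2 * Λ := by gcongr
    _ = 4 * κ ^ 2 * w ^ 2 * Λ * B ^ 2 := by ring
    _ ≤ 4 * κ ^ 2 * w ^ 2 * Λ * (A * C) := by gcongr
    _ = 4 * κ ^ 2 * ((A * w) * (w * Λ * C)) := by ring
    _ ≤ 4 * κ ^ 2 * (τ * (8 * ∑ t ∈ Finset.range τ, g t)) := by gcongr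
    _ = _ := by ring

/-! ### Cumulative lower bound for query machines -/

namespace MatMul

/-- The bound on T grows with l = log₂ d, which is not bounded in terms of n. Hence the exponent is
split: one half is at least (C + 6) lg and gives a power of n, the other is at least l/4096 and
gives a factor 8192/l that absorbs l. -/
theorem union_bound_numeric {C C₀ n T : ℕ} {l lg κ : ℝ} (hlg : lg = Real.logb 2 n)
    (hl : 1 ≤ l) (hlg1 : 1 ≤ lg) (hκ : 1 ≤ κ) (hκl : 4096 * (C + 6) * lg ≤ κ * l)
    (hn : 32768 * C₀ + 2 ≤ n) (hT : (T : ℝ) ≤ n ^ 3 * √(l / lg)) :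
    T * n * (C₀ * (2 : ℝ) ^ (-(κ * l / 2048))) ≤ 1 / (4 * n ^ C) := by
  have hn0 : (0 : ℝ) < n := by exact_mod_cast (by omega : 0 < n)
  have hn' : 32768 * (C₀ : ℝ) + 2 ≤ n := by exact_mod_cast hn
  have hC0 : (0 : ℝ) ≤ C₀ := Nat.cast_nonneg _
  have hT' : (T : ℝ) ≤ n ^ 3 * l := by
    refine hT.trans ?_
    gcongr
    rw [Real.sqrt_le_left (by linarith)]
    calc l / lg ≤ l := div_le_self (by linarith) hlg1
      _ ≤ l ^ 2 := by nlinarith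
  have h2n : (2 : ℝ) ^ lg = n := by rw [hlg]; exact Real.rpow_logb (by norm_num) (by norm_num) hn0
  have hsplit : (2 : ℝ) ^ (-(κ * l / 2048)) ≤ 1 / n ^ (C + 6) * (8192 / l) := by
    have h1 : (2 : ℝ) ^ (-(κ * l / 2048)) ≤ 2 ^ (-(lg * (C + 6 : ℕ))) * 2 ^ (-(l / 4096)) := by
      rw [← Real.rpow_add (by norm_num)]
      apply Real.rpow_le_rpow_of_exponent_le (by norm_num)
      push_cast
      have : l ≤ κ * l := by nlinarith
      linarith
    refine h1.trans ?_
    apply mul_le_mul _ _ (by positivity) (by positivity)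
    · rw [Real.rpow_neg (by norm_num), Real.rpow_mul (by norm_num), h2n, Real.rpow_natCast, one_div]
    · rw [Real.rpow_neg (by norm_num), ← one_div, div_le_div_iff₀ (by positivity) (by linarith)]
      have hexp : l / 4096 / 2 ≤ (2 : ℝ) ^ (l / 4096) := by
        rw [Real.rpow_def_of_pos (by norm_num)]
        have := Real.add_one_le_exp (Real.log 2 * (l / 4096))
        have h2 := Real.log_two_gt_d9
        nlinarith
      linarith
  calc (T : ℝ) * n * (C₀ * (2 : ℝ) ^ (-(κ * l / 2048)))
      ≤ (n ^ 3 * l) * n * (C₀ * (1 / n ^ (C + 6) * (8192 / l))) := by gcongr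
    _ = (8192 * C₀ / n ^ 2) * (1 / n ^ C) := by
        have : l ≠ 0 := by linarith
        field_simp
        ring
    _ ≤ 1 / 4 * (1 / n ^ C) := by
        refine mul_le_mul_of_nonneg_right ?_ (by positivity)
        rw [div_le_div_iff₀ (by positivity) (by norm_num)]
        nlinarith
    _ = _ := by rw [one_div_mul_one_div]

/-- A block of kind 0 yields at most r² - 1 outputs, and r² - 1 = (r - 1)(r + 1) ≤ 2rρ, since r is ρ
rounded up. As ρ √(l/lg) = √C₂, the time threshold is just what keeps these blocks below half of n².
For ρ ≤ 1 they yield nothing. -/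
theorem base_blocks_numeric {n l lg ρ r m C₂ ε τ : ℝ} (hn0 : 0 < n) (hl1 : 1 ≤ l)
    (hlg1 : 1 ≤ lg) (hlgn : lg ≤ n) (hρ : ρ = √(C₂ * lg / l)) (hρ0 : 0 < ρ) (hr1 : 1 ≤ r)
    (hrρ : r < ρ + 1) (hC₂ : 1 ≤ C₂) (hn16 : 16 * C₂ ≤ n) (hε0 : 0 < ε)
    (hεC : ε * C₂ = 1 / 2 ^ 32) (hnm : n / 256 ≤ m)
    (hτ : τ ≤ ε * (n ^ 3 * √(l / lg))) :
    (τ + m * r) * (r ^ 2 - 1) ≤ m * r * (n * n) / 2 := by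
  have hm0 : 0 < m := lt_of_lt_of_le (by positivity) hnm
  have hκρ : r ^ 2 - 1 ≤ ρ * (2 * r) := by
    have : (r - 1) * (r + 1) ≤ ρ * (2 * r) := by
      apply mul_le_mul <;> linarith
    linarith
  have hκ0 : 0 ≤ r ^ 2 - 1 := by nlinarith
  have hsq : √(l / lg) * ρ ≤ C₂ := by
    rw [hρ, ← Real.sqrt_mul (by positivity),
      show l / lg * (C₂ * lg / l) = C₂ by field_simp, Real.sqrt_le_left (by positivity)]
    nlinarith
  have h1 : τ * (r ^ 2 - 1) ≤ m * r * (n * n) / 4 := by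
    calc τ * (r ^ 2 - 1) ≤ (ε * (n ^ 3 * √(l / lg))) * (ρ * (2 * r)) :=
          mul_le_mul hτ hκρ hκ0 (by positivity)
      _ = ε * (√(l / lg) * ρ) * (2 * r * n ^ 3) := by ring
      _ ≤ ε * C₂ * (2 * r * n ^ 3) := by gcongr
      _ = (n / 256 * r * (n * n) / 4) * (2048 / 2 ^ 32) := by rw [hεC]; ring
      _ ≤ (n / 256 * r * (n * n) / 4) * 1 :=
          mul_le_mul_of_nonneg_left (by norm_num) (by positivity)
      _ ≤ m * r * (n * n) / 4 := by rw [mul_one]; gcongr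
  have h2 : r ^ 2 - 1 ≤ n * n / 4 := by
    have hρn : ρ ^ 2 ≤ C₂ * n := by
      rw [hρ, Real.sq_sqrt (by positivity)]
      calc C₂ * lg / l ≤ C₂ * lg := div_le_self (by positivity) hl1
        _ ≤ _ := by gcongr
    nlinarith [sq_nonneg (ρ - 1)]
  have h3 : m * r * (r ^ 2 - 1) ≤ m * r * (n * n / 4) := by gcongr
  linarith

/-- With κ = r², w = mr and Λ = r²l/2048 all powers of r cancel, so the choice of κ costs nothing in
the product bound. -/
theorem product_bound_numeric {n l r m ε y : ℝ} (hn0 : 0 < n) (hl : 0 ≤ l) (hr1 : 1 ≤ r)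
    (hε : ε ≤ 1 / 2 ^ 32) (hnm : n / 256 ≤ m)
    (h : (n * n) ^ 2 * (m * r) ^ 2 * (r ^ 2 * l / 2048) ≤ 32 * (r ^ 2) ^ 2 * y) :
    ε * (n ^ 6 * l) ≤ y := by
  have hr4 : 0 < r ^ 4 := by positivity
  have h1 : r ^ 4 * (n ^ 4 * m ^ 2 * l / 65536) ≤ r ^ 4 * y := by
    have : r ^ 4 * (n ^ 4 * m ^ 2 * l / 65536)
      = (n * n) ^ 2 * (m * r) ^ 2 * (r ^ 2 * l / 2048) / 32 := by ring
    rw [this]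
    linarith
  calc ε * (n ^ 6 * l) ≤ (1 / 2 ^ 32) * (n ^ 6 * l) := by gcongr
    _ = n ^ 4 * (n / 256) ^ 2 * l / 65536 := by ring
    _ ≤ n ^ 4 * m ^ 2 * l / 65536 := by gcongr
    _ ≤ y := le_of_mul_le_mul_left h1 hr4

variable {F : Type u} [Field F] {n : ℕ}

open scoped Classical in
theorem card_not_rigidPair_le {D : Finset F} {h : ℕ} {β : ℝ}
    (hβ : (Nat.card {a : Fin n × Fin n → D //
        ¬ Rigid h (fun i j => (a (i, j) : F) : Matrix (Fin n) (Fin n) F)} : ℝ)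
        ≤ (D.card : ℝ) ^ (n * n) * β) :
    ((Finset.univ.filter fun x : Idx n → D => ¬ RigidPair h x).card : ℝ)
      ≤ (D.card : ℝ) ^ (n * n) * (D.card : ℝ) ^ (n * n) * (2 * β) := by
  set B := Finset.univ.filter fun a : Fin n × Fin n → D =>
        ¬ Rigid h (fun i j => (a (i, j) : F) : Matrix (Fin n) (Fin n) F) with hB
  have hBc : (B.card : ℝ) ≤ (D.card : ℝ) ^ (n * n) * β := by
    rwa [Nat.card_eq_fintype_card, Fintype.card_subtype] at hβ
  have hU : (Finset.univ : Finset (Fin n × Fin n → D)).card = D.card ^ (n * n) := by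
    rw [Finset.card_univ, Fintype.card_fun, Fintype.card_coe, Fintype.card_prod, Fintype.card_fin]
  let S₁ := Finset.univ.filter fun x : Idx n → D => ¬ Rigid h (right x)
  let S₂ := Finset.univ.filter fun x : Idx n → D => ¬ Rigid h (left x).transpose
  have h1 : S₁.card ≤ D.card ^ (n * n) * B.card := by
    rw [← hU, ← Finset.card_product]
    apply Finset.card_le_card_of_injOn (fun x => (fun p => x (.inl p), fun p => x (.inr p)))
    · intro x hx
      have hx' : ¬ Rigid h (right x) := by simpa [S₁] using hx
      simp only [Finset.coe_product, Set.mem_prod, Finset.coe_univ, Set.mem_univ, true_and,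
        Finset.mem_coe, hB, Finset.mem_filter, Finset.mem_univ]
      exact hx'
    · intro x _ y _ hxy
      rw [Prod.mk.injEq] at hxy
      funext i
      rcases i with i | i
      · exact congrFun hxy.1 i
      · exact congrFun hxy.2 i
  have h2 : S₂.card ≤ D.card ^ (n * n) * B.card := by
    rw [← hU, ← Finset.card_product]
    apply Finset.card_le_card_of_injOn (fun x => (fun p => x (.inr p), fun p => x (.inl p.swap)))
    · intro x hx
      have hx' : ¬ Rigid h (left x).transpose := by simpa [S₂] using hx
      simp only [Finset.coe_product, Set.mem_prod, Finset.coe_univ, Set.mem_univ, true_and,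
        Finset.mem_coe, hB, Finset.mem_filter, Finset.mem_univ]
      exact hx'
    · intro x _ y _ hxy
      rw [Prod.mk.injEq] at hxy
      funext i
      rcases i with i | i
      · exact congrFun hxy.2 i.swap
      · exact congrFun hxy.1 i
  have hsub : (Finset.univ.filter fun x : Idx n → D => ¬ RigidPair h x) ⊆ S₁ ∪ S₂ := by
    intro x hx
    have hx' : ¬ RigidPair h x := by simpa using hx
    simp only [S₁, S₂, Finset.mem_union, Finset.mem_filter, Finset.mem_univ, true_and]
    unfold RigidPair at hx'
    tauto
  have h3 : (Finset.univ.filter fun x : Idx n → D => ¬ RigidPair h x).card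
      ≤ D.card ^ (n * n) * B.card + D.card ^ (n * n) * B.card :=
    (Finset.card_le_card hsub).trans ((Finset.card_union_le _ _).trans (Nat.add_le_add h1 h2))
  have h4 : ((Finset.univ.filter fun x : Idx n → D => ¬ RigidPair h x).card : ℝ)
      ≤ (D.card : ℝ) ^ (n * n) * B.card + (D.card : ℝ) ^ (n * n) * B.card := by exact_mod_cast h3
  have h5 : (D.card : ℝ) ^ (n * n) * B.card ≤ (D.card : ℝ) ^ (n * n) * ((D.card : ℝ) ^ (n * n) * β) := by
    gcongr
  linarith

open scoped Classical in
/-- Union bound over all starting times, block kinds and cheap states. -/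
theorem card_rigid_advancing_le (D : Finset F) (hD : 1 ≤ D.card) (h : ℕ) (hh : n ≤ 128 * h)
    (P : QueryMachine (Idx n) (Fin n × Fin n) D F) (V : ℕ → ℝ → Finset P.State) (C₀ : ℕ)
    (hV : ∀ s y, 0 ≤ y → ((V s y).card : ℝ) ≤ C₀ * 2 ^ y)
    (T κ : ℕ) (q : ℕ → ℕ) (hq : ∀ i, q i ^ 2 ≤ h ^ 2 * (κ * 4 ^ i))
    {Λ : ℝ} (hΛ : Λ = κ * Real.logb 2 D.card / 2048) :
    ((Finset.univ.filter fun x : Idx n → D => RigidPair h x ∧ ∃ s < T, ∃ i < n,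
        ∃ v ∈ V s (4 ^ i * Λ), Advances P v (q i) (κ * 4 ^ i) x).card : ℝ)
      ≤ (D.card : ℝ) ^ (n * n) * (D.card : ℝ) ^ (n * n) * (T * n * (C₀ * 2 ^ (-Λ))) := by
  have hd : (0 : ℝ) < D.card := by exact_mod_cast hD
  have hd1 : (1 : ℝ) ≤ D.card := by exact_mod_cast hD
  have hl0 : 0 ≤ Real.logb 2 D.card := Real.logb_nonneg (by norm_num) hd1
  have hΛ0 : 0 ≤ Λ := by rw [hΛ]; positivity
  set X : ℝ := (D.card : ℝ) ^ (n * n) * (D.card : ℝ) ^ (n * n) with hX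
  have hX0 : 0 ≤ X := by positivity
  let S : (i : ℕ) → P.State → Finset (Idx n → D) := fun i v =>
    Finset.univ.filter fun x : Idx n → D => RigidPair h x ∧ Advances P v (q i) (κ * 4 ^ i) x
  -- Λ is defined with half of the available exponent κl/1024: one half pays for the number of cheap
  -- states, the other survives.
  have hS : ∀ i v, ((S i v).card : ℝ) ≤ X * 2 ^ (-(2 * (4 ^ i * Λ))) := by
    intro i v
    have h1 := card_advances_mul_le D hD h hh P v (q i) (κ * 4 ^ i) ((κ * 4 ^ i + 1023) / 1024)
      (hq i) (by omega)
    set R := (κ * 4 ^ i + 1023) / 1024 with hR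
    have h2 : ((S i v).card : ℝ) * (D.card : ℝ) ^ R ≤ X := by
      rw [hX]; exact_mod_cast h1
    have h3 : (κ : ℝ) * 4 ^ i / 1024 ≤ R := by
      rw [div_le_iff₀ (by norm_num)]
      exact_mod_cast (by omega : κ * 4 ^ i ≤ R * 1024)
    have h4 : (2 : ℝ) ^ (2 * (4 ^ i * Λ)) ≤ (D.card : ℝ) ^ R := by
      have : (D.card : ℝ) = 2 ^ Real.logb 2 D.card :=
        (Real.rpow_logb (by norm_num) (by norm_num) hd).symm
      rw [this, ← Real.rpow_mul_natCast (by norm_num)]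
      apply Real.rpow_le_rpow_of_exponent_le (by norm_num)
      rw [hΛ]
      nlinarith
    rw [Real.rpow_neg (by norm_num), ← div_eq_mul_inv, le_div_iff₀ (by positivity)]
    calc _ ≤ ((S i v).card : ℝ) * (D.card : ℝ) ^ R := by gcongr
      _ ≤ X := h2
  have hsub : (Finset.univ.filter fun x : Idx n → D => RigidPair h x ∧ ∃ s < T, ∃ i < n,
        ∃ v ∈ V s (4 ^ i * Λ), Advances P v (q i) (κ * 4 ^ i) x)
      ⊆ (Finset.range T).biUnion fun s => (Finset.range n).biUnion fun i =>
          (V s (4 ^ i * Λ)).biUnion fun v => S i v := by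
    intro x hx
    simp only [Finset.mem_filter, Finset.mem_univ, true_and] at hx
    obtain ⟨hr, s, hs, i, hi, v, hv, ha⟩ := hx
    simp only [Finset.mem_biUnion, Finset.mem_range]
    exact ⟨s, hs, i, hi, v, hv, by simp [S, hr, ha]⟩
  calc _ ≤ ((((Finset.range T).biUnion fun s => (Finset.range n).biUnion fun i =>
          (V s (4 ^ i * Λ)).biUnion fun v => S i v).card : ℕ) : ℝ) := by
        exact_mod_cast Finset.card_le_card hsub
    _ ≤ ∑ s ∈ Finset.range T, ∑ i ∈ Finset.range n, ∑ v ∈ V s (4 ^ i * Λ), ((S i v).card : ℝ) := by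
        have : ((Finset.range T).biUnion fun s => (Finset.range n).biUnion fun i =>
          (V s (4 ^ i * Λ)).biUnion fun v => S i v).card
          ≤ ∑ s ∈ Finset.range T, ∑ i ∈ Finset.range n, ∑ v ∈ V s (4 ^ i * Λ), (S i v).card :=
          Finset.card_biUnion_le.trans (Finset.sum_le_sum fun s _ =>
            Finset.card_biUnion_le.trans (Finset.sum_le_sum fun i _ => Finset.card_biUnion_le))
        exact_mod_cast this
    _ ≤ ∑ s ∈ Finset.range T, ∑ i ∈ Finset.range n, X * (C₀ * 2 ^ (-Λ)) := by
        refine Finset.sum_le_sum fun s _ => Finset.sum_le_sum fun i _ => ?_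
        have h4 : Λ ≤ 4 ^ i * Λ := le_mul_of_one_le_left hΛ0 (one_le_pow₀ (by norm_num))
        have hy : 0 ≤ 4 ^ i * Λ := by positivity
        calc _ ≤ ∑ v ∈ V s (4 ^ i * Λ), X * (2 : ℝ) ^ (-(2 * (4 ^ i * Λ))) :=
              Finset.sum_le_sum fun v _ => hS i v
          _ = (V s (4 ^ i * Λ)).card * (X * (2 : ℝ) ^ (-(2 * (4 ^ i * Λ)))) := by
              rw [Finset.sum_const, nsmul_eq_mul]
          _ ≤ (C₀ * 2 ^ (4 ^ i * Λ)) * (X * (2 : ℝ) ^ (-(2 * (4 ^ i * Λ)))) := by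
              gcongr; exact hV s _ hy
          _ = X * (C₀ * (2 : ℝ) ^ (-(4 ^ i * Λ))) := by
              rw [show -(4 ^ i * Λ) = 4 ^ i * Λ + -(2 * (4 ^ i * Λ)) by ring,
                Real.rpow_add (by norm_num)]
              ring
          _ ≤ X * (C₀ * (2 : ℝ) ^ (-Λ)) := by
              gcongr
              norm_num
    _ = _ := by
      rw [Finset.sum_const, Finset.sum_const, Finset.card_range, Finset.card_range, nsmul_eq_mul,
        nsmul_eq_mul]
      ring

/-- The common core of both models. G is the set of successful inputs, g the cost, and V s y
contains the states of cost at most y met at time s. Nonrigid inputs and inputs with an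
overproductive cheap block each amount to at most a quarter of the guaranteed size of G, so some
input in G is neither, and the block argument runs on it alone. The choice of ε precedes C₀, so that
program length affects only n₀. -/
theorem exists_cumulative_lower_bound (C : ℕ) : ∃ ε > (0 : ℝ), ∀ C₀ : ℕ, ∃ n₀ : ℕ, ∀ n ≥ n₀,
    ∀ (F : Type u) [Field F] (D : Finset F) (_ : 2 ≤ D.card)
      (P : QueryMachine (Idx n) (Fin n × Fin n) D F) (v₀ : P.State)
      (V : ℕ → ℝ → Finset P.State) (_ : ∀ s y, 0 ≤ y → ((V s y).card : ℝ) ≤ C₀ * 2 ^ y)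
      (G : Set (Idx n → D)) (τ : (Idx n → D) → ℕ) (g : (Idx n → D) → ℕ → ℝ) (T : ℕ),
      (T : ℝ) ≤ ε * (n ^ 3 * √(Real.logb 2 D.card / Real.logb 2 n)) →
      (∀ x ∈ G, τ x ≤ T) → (∀ x ∈ G, ∀ t, 0 ≤ g x t) → (∀ x ∈ G, g x 0 = 0) →
      (∀ x ∈ G, ∀ s < τ x, ∀ y, g x s ≤ y → P.run v₀ x s ∈ V s y) →
      (∀ x ∈ G, ∀ t, ∀ e ∈ P.emit (P.run v₀ x t) x, e.2 = product x e.1) →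
      (∀ x ∈ G, ∀ j, ∃ t < τ x, ∃ o, (j, o) ∈ P.emit (P.run v₀ x t) x) →
      (Nat.card (Idx n → D) : ℝ) / n ^ C ≤ Nat.card G →
      ∃ x ∈ G, ε * (n ^ 6 * Real.logb 2 D.card) ≤ T * ∑ t ∈ Finset.range (τ x), g x t := by
  obtain ⟨n₁, hn₁⟩ := exists_card_not_rigid_le.{u} C
  obtain ⟨C₂, hC₂⟩ : ∃ C₂ : ℕ, C₂ = 4096 * (C + 6) := ⟨_, rfl⟩
  have hC₂1 : (1 : ℝ) ≤ C₂ := by exact_mod_cast (by omega : 1 ≤ C₂)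
  obtain ⟨ε, hε⟩ : ∃ ε : ℝ, ε = 1 / (2 ^ 32 * C₂) := ⟨_, rfl⟩
  have hε0 : 0 < ε := by rw [hε]; positivity
  have hεC : ε * C₂ = 1 / 2 ^ 32 := by rw [hε]; field_simp
  refine ⟨ε, hε0, fun C₀ => ⟨n₁ + 128 + 32768 * C₀ + 16 * C₂, ?_⟩⟩
  intro n hn F _ D hD P v₀ V hV G τ g T hT hτ hg hg0 hmem hcor hall hG
  classical
  set l := Real.logb 2 D.card with hl
  set lg := Real.logb 2 n with hlg
  have hn0 : (0 : ℝ) < n := by exact_mod_cast (by omega : 0 < n)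
  have hl1 : 1 ≤ l := by
    rw [hl, Real.le_logb_iff_rpow_le (by norm_num) (by positivity)]
    simpa using hD
  have hlg1 : 1 ≤ lg := by
    rw [hlg, Real.le_logb_iff_rpow_le (by norm_num) hn0]
    simpa using (by omega : 2 ≤ n)
  have hlgn : lg ≤ n := by
    rw [hlg, Real.logb_le_iff_le_rpow (by norm_num) hn0, Real.rpow_natCast]
    exact_mod_cast Nat.lt_two_pow_self.le
  -- The least κ with κl ≥ C₂ lg, as the union bound requires, would be ρ². Rounding ρ up makes κ =
  -- r² a square, so that w = mr satisfies (2^(i+1) w)² = (2m)² κ 4^i exactly.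
  obtain ⟨ρ, hρ⟩ : ∃ ρ : ℝ, ρ = √(C₂ * lg / l) := ⟨_, rfl⟩
  have hρ0 : 0 < ρ := hρ ▸ Real.sqrt_pos.2 (by positivity)
  have hρ2 : ρ ^ 2 = C₂ * lg / l := hρ ▸ Real.sq_sqrt (by positivity)
  obtain ⟨r, hr⟩ : ∃ r : ℕ, r = ⌈ρ⌉₊ := ⟨_, rfl⟩
  have hr1 : 1 ≤ r := hr ▸ Nat.one_le_ceil_iff.2 hρ0
  have hr1' : (1 : ℝ) ≤ r := by exact_mod_cast hr1
  have hrρ : ρ ≤ r := hr ▸ Nat.le_ceil ρ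
  have hrρ' : (r : ℝ) < ρ + 1 := hr ▸ Nat.ceil_lt_add_one hρ0.le
  obtain ⟨m, hm⟩ : ∃ m, m = n / 128 := ⟨_, rfl⟩
  have hm1 : 1 ≤ m := by omega
  have hnm : n ≤ 256 * m := by omega
  have hnm' : (n : ℝ) / 256 ≤ m := by
    rw [div_le_iff₀ (by norm_num)]; exact_mod_cast (by omega : n ≤ m * 256)
  obtain ⟨κ, hκ⟩ : ∃ κ, κ = r ^ 2 := ⟨_, rfl⟩
  have hκ1 : 1 ≤ κ := hκ ▸ Nat.one_le_pow _ _ hr1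
  have hκr : (κ : ℝ) = r ^ 2 := by rw [hκ]; push_cast; rfl
  obtain ⟨w, hw⟩ : ∃ w, w = m * r := ⟨_, rfl⟩
  have hw1 : 1 ≤ w := hw ▸ Nat.mul_pos hm1 hr1
  have hwr : (w : ℝ) = m * r := by rw [hw]; push_cast; rfl
  have hq : ∀ i, (2 ^ (i + 1) * w) ^ 2 ≤ (2 * m) ^ 2 * (κ * 4 ^ i) := by
    intro i
    rw [hw, hκ, show (4 : ℕ) = 2 ^ 2 by norm_num, ← pow_mul]
    apply le_of_eq
    ring
  obtain ⟨Λ, hΛ⟩ : ∃ Λ : ℝ, Λ = κ * l / 2048 := ⟨_, rfl⟩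
  have hκ1' : (1 : ℝ) ≤ κ := by exact_mod_cast hκ1
  have hΛ0 : 0 < Λ := by rw [hΛ]; positivity
  have hκl : 4096 * ((C : ℝ) + 6) * lg ≤ κ * l := by
    have h1 : C₂ * lg / l ≤ κ := by
      rw [← hρ2, hκr]; gcongr
    rw [div_le_iff₀ (by linarith)] at h1
    rw [hC₂] at h1
    push_cast at h1
    exact h1
  have hε1 : ε ≤ 1 := by
    have : ε * 1 ≤ ε * C₂ := by gcongr
    rw [hεC, mul_one] at this
    refine this.trans (by norm_num)
  have hT1 : (T : ℝ) ≤ n ^ 3 * √(l / lg) :=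
    hT.trans (mul_le_of_le_one_left (by positivity) hε1)
  have hnum := union_bound_numeric (C₀ := C₀) hlg hl1 hlg1 hκ1' hκl (by omega) hT1
  set X : ℝ := (D.card : ℝ) ^ (n * n) * (D.card : ℝ) ^ (n * n) with hX
  have hd0 : (0 : ℝ) < D.card := by exact_mod_cast (by omega : 0 < D.card)
  have hX0 : 0 < X := by positivity
  have hXc : (Nat.card (Idx n → D) : ℝ) = X := by
    rw [Nat.card_eq_fintype_card, Fintype.card_fun, Fintype.card_coe, Fintype.card_sum,
      Fintype.card_prod, Fintype.card_fin, pow_add, hX]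
    push_cast; rfl
  have hrig := hn₁ n (by omega) F D hD
  rw [← hm, div_eq_mul_inv] at hrig
  rw [← hΛ] at hnum
  have hbad₁ := card_not_rigidPair_le hrig
  have hbad₂ := card_rigid_advancing_le D (by omega) (2 * m) (by omega) P V C₀ hV T κ
    (fun i => 2 ^ (i + 1) * w) hq hΛ
  set B₁ := Finset.univ.filter fun x : Idx n → D => ¬ RigidPair (2 * m) x with hB₁
  set B₂ := Finset.univ.filter fun x : Idx n → D => RigidPair (2 * m) x ∧ ∃ s < T, ∃ i < n,
        ∃ v ∈ V s (4 ^ i * Λ), Advances P v (2 ^ (i + 1) * w) (κ * 4 ^ i) x with hB₂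
  have hgood : ∃ x ∈ G, x ∉ B₁ ∪ B₂ := by
    by_contra hcon
    push Not at hcon
    have hle : Nat.card G ≤ (B₁ ∪ B₂).card := by
      have := Set.ncard_le_ncard (s := G) (t := ((B₁ ∪ B₂ : Finset _) : Set (Idx n → D)))
        (fun x hx => hcon x hx) (Finset.finite_toSet _)
      rwa [Set.ncard_coe_finset] at this
    have hle' : (Nat.card G : ℝ) ≤ B₁.card + B₂.card := by
      exact_mod_cast hle.trans (Finset.card_union_le _ _)
    rw [hXc] at hG
    have h1 : X * (2 * (8 * (n : ℝ) ^ C)⁻¹) = 1 / 4 * (X / n ^ C) := by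
      field_simp; norm_num
    have h2 : X * (T * n * (C₀ * (2 : ℝ) ^ (-Λ))) ≤ 1 / 4 * (X / n ^ C) := by
      calc _ ≤ X * (1 / (4 * n ^ C)) := by gcongr
        _ = _ := by field_simp
    have h3 : 0 < X / (n : ℝ) ^ C := by positivity
    linarith
  obtain ⟨x, hxG, hxB⟩ := hgood
  have hxr : RigidPair (2 * m) x := by
    by_contra hc
    exact hxB (by simp [hB₁, hc])
  refine ⟨x, hxG, ?_⟩
  let N : ℕ → ℕ := fun e => (Prod.fst '' P.emitted v₀ x e).ncard
  have hNle : ∀ A : Set ((Fin n × Fin n) × F), (Prod.fst '' A).ncard ≤ n * n := by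
    intro A
    refine (Set.ncard_le_card _).trans ?_
    simp
  have hN0 : N 0 = 0 := by
    have : P.emitted v₀ x 0 = ∅ := by
      ext e; simp [QueryMachine.emitted]
    simp [N, this]
  have hNτ : N (τ x) = n * n := by
    have : Prod.fst '' P.emitted v₀ x (τ x) = Set.univ := by
      rw [Set.eq_univ_iff_forall]
      intro j
      obtain ⟨t, ht, o, ho⟩ := hall x hxG j
      exact ⟨(j, o), ⟨t, ht, ho⟩, rfl⟩
    simp [N, this, Set.ncard_univ]
  have hN : ∀ s e i, s < e → e ≤ τ x → e ≤ s + 2 ^ (i + 1) * w → g x s ≤ 4 ^ i * Λ →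
      N e + 1 ≤ N s + κ * 4 ^ i := by
    intro s e i hse heτ hesi hgs
    have h1 : N e ≤ N s + (Prod.fst '' P.emitted (P.run v₀ x s) x (2 ^ (i + 1) * w)).ncard := by
      refine le_trans (Set.ncard_le_ncard ?_ (Set.toFinite _)) (Set.ncard_union_le _ _)
      rw [← Set.image_union]
      exact Set.image_mono ((P.emitted_mono v₀ x hesi).trans (P.emitted_add_subset v₀ x s _))
    have h2 : (Prod.fst '' P.emitted (P.run v₀ x s) x (2 ^ (i + 1) * w)).ncard < κ * 4 ^ i := by
      by_contra hc
      push Not at hc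
      -- For i ≥ n the claimed number of outputs exceeds n², so the union bound over i < n suffices.
      by_cases hi : i < n
      · apply hxB
        refine Finset.mem_union_right _ ?_
        rw [hB₂, Finset.mem_filter]
        refine ⟨Finset.mem_univ _, hxr, s, by have := hτ x hxG; omega, i, hi, P.run v₀ x s,
          hmem x hxG s (by omega) _ hgs, ?_, hc⟩
        rintro e ⟨t, _, he⟩
        rw [← P.run_add] at he
        exact hcor x hxG _ e he
      · have h3 := hc.trans (hNle _)
        have h4 : n * n < 4 ^ i := by
          calc n * n < 2 ^ n * 2 ^ n :=
                Nat.mul_lt_mul'' Nat.lt_two_pow_self Nat.lt_two_pow_self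
            _ = 4 ^ n := by rw [← mul_pow]; norm_num
            _ ≤ 4 ^ i := Nat.pow_le_pow_right (by norm_num) (by omega)
        have h5 : 4 ^ i ≤ κ * 4 ^ i := Nat.le_mul_of_pos_left _ hκ1
        omega
    omega
  have hτT : (τ x : ℝ) ≤ T := by exact_mod_cast hτ x hxG
  have hbase : ((τ x : ℝ) + w) * ((κ : ℝ) - 1) ≤ w * N (τ x) / 2 := by
    rw [hNτ, hwr, hκr]
    push_cast
    exact base_blocks_numeric hn0 hl1 hlg1 hlgn hρ hρ0 hr1' hrρ' hC₂1
      (by exact_mod_cast (by omega : 16 * C₂ ≤ n)) hε0 hεC hnm' (hτT.trans hT)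
  have hfin := sq_mul_le_cumulative (g x) (hg x hxG) Λ hΛ0 (by rw [hg0 x hxG]; exact hΛ0.le) w κ (τ x)
    hw1 hκ1 N hN0 hN hbase
  have hS0 : 0 ≤ ∑ t ∈ Finset.range (τ x), g x t := Finset.sum_nonneg fun t _ => hg x hxG t
  rw [hNτ, hΛ, hwr, hκr] at hfin
  push_cast at hfin
  have hεle : ε ≤ 1 / 2 ^ 32 := by
    rw [← hεC]
    exact le_mul_of_one_le_right hε0.le hC₂1
  refine (product_bound_numeric hn0 (by linarith) hr1' hεle hnm' hfin).trans ?_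
  gcongr

end MatMul

/-! ### Averaging, and branching programs as query machines -/

/-- If all values on the support were below p, so would be their mean, the total mass being 1. -/
theorem PMF.exists_mem_support_le {α : Type*} (μ : PMF α) {f : α → ℝ} (hf0 : ∀ a, 0 ≤ f a)
    (hf1 : ∀ a, f a ≤ 1) {p : ℝ} (h : p ≤ ∑' a, (μ a).toReal * f a) :
    ∃ a ∈ μ.support, p ≤ f a := by
  by_contra hcon
  push Not at hcon
  have hone : HasSum (fun a => (μ a).toReal) 1 := by
    have h1 := ENNReal.summable_toReal (f := μ) (by rw [μ.tsum_coe]; simp)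
    have h2 := ENNReal.tsum_toReal_eq (f := μ) (fun a => μ.apply_ne_top a)
    rw [μ.tsum_coe] at h2
    have := h1.hasSum
    rwa [← h2, ENNReal.toReal_one] at this
  have hs1 : Summable fun a => (μ a).toReal * f a :=
    Summable.of_nonneg_of_le (fun a => mul_nonneg ENNReal.toReal_nonneg (hf0 a))
      (fun a => mul_le_of_le_one_right ENNReal.toReal_nonneg (hf1 a)) hone.summable
  obtain ⟨a₀, ha₀⟩ := μ.support_nonempty
  have hpos : 0 < (μ a₀).toReal :=
    ENNReal.toReal_pos ((μ.mem_support_iff a₀).1 ha₀) (μ.apply_ne_top a₀)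
  have hlt : ∑' a, (μ a).toReal * f a < ∑' a, (μ a).toReal * p := by
    refine Summable.tsum_lt_tsum (i := a₀) (fun a => ?_) ?_ hs1 (hone.summable.mul_right p)
    · by_cases ha : a ∈ μ.support
      · exact mul_le_mul_of_nonneg_left (hcon a ha).le ENNReal.toReal_nonneg
      · rw [(μ.apply_eq_zero_iff a).2 ha]; simp
    · exact mul_lt_mul_of_pos_left (hcon a₀ ha₀) hpos
  rw [tsum_mul_right, hone.tsum_eq, one_mul] at hlt
  linarith

namespace BranchingProgram

variable {ι κ D R : Type*} (P : BranchingProgram ι κ D R)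

/-- A branching program as a query machine; `none` stands for having passed a sink. -/
def toQueryMachine : QueryMachine ι κ D R where
  State := Option (Σ t, Fin (P.width t))
  query v := v.bind fun u => P.query u.1 u.2
  step v x := v.bind fun u => (P.query u.1 u.2).map fun i => ⟨u.1 + 1, P.next u.1 u.2 (x i)⟩
  emit v x := {e | ∃ u i, v = some u ∧ u.1 < P.time ∧ P.query u.1 u.2 = some i ∧
    e ∈ P.out u.1 u.2 (x i)}
  step_congr := by
    rintro (_ | u) x y h
    · rfl
    · cases hq : P.query u.1 u.2 with
      | none => simp [hq]
      | some i => simp [hq, h i (by simp [hq])]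
  emit_congr := by
    rintro v x y h
    ext e
    refine exists_congr fun u => exists_congr fun i => and_congr_right fun hv =>
      and_congr_right fun _ => and_congr_right fun hq => ?_
    rw [h i (by simp [hv, hq])]

/-- The root of the program. -/
def rootState : P.toQueryMachine.State := some ⟨0, ⟨0, by simp [P.width_zero]⟩⟩

theorem run_rootState (x : ι → D) (t : ℕ) :
    P.toQueryMachine.run P.rootState x t = (P.node x t).map (Sigma.mk t) := by
  induction t with
  | zero => rfl
  | succ t ih =>
    rw [QueryMachine.run_add, ih]
    change P.toQueryMachine.step _ x = _
    rw [node]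
    cases P.node x t with
    | none => rfl
    | some v =>
      simp only [toQueryMachine, Option.map_some, Option.bind_some]
      cases P.query t v <;> rfl

theorem mem_emit_run_iff (x : ι → D) (t : ℕ) (e : κ × R) :
    e ∈ P.toQueryMachine.emit (P.toQueryMachine.run P.rootState x t) x ↔
      t < P.time ∧ ∃ v i, P.node x t = some v ∧ P.query t v = some i ∧ e ∈ P.out t v (x i) := by
  rw [run_rootState]
  constructor
  · rintro ⟨u, i, hu, ht, hq, he⟩
    rw [Option.map_eq_some_iff] at hu
    obtain ⟨v, hv, rfl⟩ := hu
    exact ⟨ht, v, i, hv, hq, he⟩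
  · rintro ⟨ht, v, i, hv, hq, he⟩
    exact ⟨⟨t, v⟩, i, by rw [hv]; rfl, ht, hq, he⟩

theorem logb_width_nonneg (t : ℕ) : 0 ≤ Real.logb 2 (P.width t) := by
  rcases Nat.eq_zero_or_pos (P.width t) with h | h
  · simp [h]
  · exact Real.logb_nonneg (by norm_num) (by exact_mod_cast h)

open scoped Classical in
/-- The states reachable after `s` steps, provided that the layer has at most `2 ^ y` nodes. -/
noncomputable def cheapStates (s : ℕ) (y : ℝ) : Finset P.toQueryMachine.State :=
  if Real.logb 2 (P.width s) ≤ y then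
    insert none (Finset.univ.image fun v : Fin (P.width s) => some ⟨s, v⟩) else ∅

/-- The extra state `none` gives 2^y + 1 ≤ 2 · 2^y, whence C₀ = 2 for branching programs. -/
theorem card_cheapStates_le (s : ℕ) (y : ℝ) (hy : 0 ≤ y) :
    ((P.cheapStates s y).card : ℝ) ≤ (2 : ℕ) * 2 ^ y := by
  classical
  have h1 : (1 : ℝ) ≤ 2 ^ y := Real.one_le_rpow (by norm_num) hy
  unfold cheapStates
  split_ifs with h
  · have h2 : (P.width s : ℝ) ≤ 2 ^ y := by
      rcases Nat.eq_zero_or_pos (P.width s) with h0 | h0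
      · rw [h0]; simp; positivity
      · rwa [Real.logb_le_iff_le_rpow (by norm_num) (by exact_mod_cast h0)] at h
    refine (Nat.cast_le (α := ℝ).2 ((Finset.card_insert_le _ _).trans (Nat.add_le_add_right
      (Finset.card_image_le.trans_eq (Finset.card_fin _)) 1))).trans ?_
    push_cast
    linarith
  · simp; positivity

theorem run_mem_cheapStates (x : ι → D) (s : ℕ) (y : ℝ) (h : Real.logb 2 (P.width s) ≤ y) :
    P.toQueryMachine.run P.rootState x s ∈ P.cheapStates s y := by
  classical
  unfold cheapStates
  rw [if_pos h, run_rootState]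
  cases P.node x s with
  | none => exact Finset.mem_insert_self _ _
  | some v =>
    exact Finset.mem_insert_of_mem (Finset.mem_image_of_mem _ (Finset.mem_univ v))

end BranchingProgram

/-! ### Counting configurations of random-access machines -/

namespace RAM

theorem sum_one_div_sq_le (k : ℕ) :
    ∑ i ∈ Finset.range k, (1 : ℝ) / ((i : ℝ) + 1) ^ 2 ≤ 2 - 1 / (k : ℝ) := by
  induction k with
  | zero => simp
  | succ k ih =>
    rw [Finset.sum_range_succ]
    rcases Nat.eq_zero_or_pos k with rfl | hk
    · norm_num
    · have hk' : (0 : ℝ) < k := by exact_mod_cast hk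
      have : (1 : ℝ) / ((k : ℝ) + 1) ^ 2 ≤ 1 / k - 1 / (k + 1) := by
        rw [div_sub_div _ _ (by positivity) (by positivity),
          div_le_div_iff₀ (by positivity) (by positivity)]
        nlinarith
      push_cast
      linarith

theorem one_div_four_pow_size_le (k : ℕ) : ((1 : ℝ) / 4) ^ Nat.size k ≤ 1 / ((k : ℝ) + 1) ^ 2 := by
  rw [one_div_pow]
  apply one_div_le_one_div_of_le (by positivity)
  have : (k : ℝ) + 1 ≤ 2 ^ Nat.size k := by exact_mod_cast Nat.lt_size_self k
  calc ((k : ℝ) + 1) ^ 2 ≤ (2 ^ Nat.size k) ^ 2 := by gcongr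
    _ = 4 ^ Nat.size k := by rw [← pow_mul, mul_comm, pow_mul]; norm_num

/-- Logarithmic-cost space of register contents given as a function. -/
def space {N : ℕ} (f : Fin N → Fin N) : ℕ :=
  ∑ r, if (f r : ℕ) = 0 then 0 else Nat.size r + Nat.size (f r)

/-- A Kraft-type argument: the weight 4^(-space) factors over the registers. By 4^(-size k) ≤ (k +
1)^(-2), register r contributes at most 1 + 2/(r + 1)², and the product stays below e⁴ < 81 for
every N. Base 2 would not do, as the sums over contents and addresses would diverge. -/
theorem card_space_le (N σ : ℕ) :
    ((Finset.univ.filter fun f : Fin N → Fin N => space f ≤ σ).card : ℝ) ≤ 81 * 4 ^ σ := by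
  let w : ℕ → ℕ → ℝ := fun r v => if v = 0 then 1 else (1 / 4) ^ (Nat.size r + Nat.size v)
  have hw0 : ∀ r v, 0 ≤ w r v := by
    intro r v; simp only [w]; split_ifs <;> positivity
  have hprod : ∀ f : Fin N → Fin N, ∏ r : Fin N, w r (f r) = (1 / 4) ^ space f := by
    intro f
    rw [space, ← Finset.prod_pow_eq_pow_sum]
    refine Finset.prod_congr rfl fun r _ => ?_
    simp only [w]
    split_ifs <;> simp
  have hrow : ∀ r : Fin N, ∑ v : Fin N, w r v ≤ Real.exp (2 * (1 / ((r : ℝ) + 1) ^ 2)) := by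
    intro r
    have h1 : ∀ v : ℕ, w r v ≤ (if v = 0 then 1 else 0)
        + 1 / ((r : ℝ) + 1) ^ 2 * (1 / ((v : ℝ) + 1) ^ 2) := by
      intro v
      simp only [w]
      split_ifs with h
      · have : (0 : ℝ) ≤ 1 / ((r : ℝ) + 1) ^ 2 * (1 / ((v : ℝ) + 1) ^ 2) := by positivity
        linarith
      · rw [zero_add, pow_add]
        exact mul_le_mul (one_div_four_pow_size_le _) (one_div_four_pow_size_le _) (by positivity)
          (by positivity)
    have h2 : ∑ v : Fin N, w r v = ∑ v ∈ Finset.range N, w r v :=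
      Fin.sum_univ_eq_sum_range (fun v => w r v) N
    have h3 : ∑ v ∈ Finset.range N, (1 : ℝ) / ((v : ℝ) + 1) ^ 2 ≤ 2 := by
      have := sum_one_div_sq_le N
      have h0 : (0 : ℝ) ≤ 1 / N := by positivity
      linarith
    have h4 : ∑ v ∈ Finset.range N, (if v = 0 then (1 : ℝ) else 0) ≤ 1 := by
      rw [Finset.sum_ite_eq']
      split_ifs <;> norm_num
    calc ∑ v : Fin N, w r v ≤ ∑ v ∈ Finset.range N, ((if v = 0 then (1 : ℝ) else 0)
          + 1 / ((r : ℝ) + 1) ^ 2 * (1 / ((v : ℝ) + 1) ^ 2)) := by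
          rw [h2]; exact Finset.sum_le_sum fun v _ => h1 v
      _ = ∑ v ∈ Finset.range N, (if v = 0 then (1 : ℝ) else 0)
          + 1 / ((r : ℝ) + 1) ^ 2 * ∑ v ∈ Finset.range N, 1 / ((v : ℝ) + 1) ^ 2 := by
          rw [Finset.sum_add_distrib, Finset.mul_sum]
      _ ≤ 1 + 1 / ((r : ℝ) + 1) ^ 2 * 2 := by gcongr
      _ ≤ _ := by
        have := Real.add_one_le_exp (2 * (1 / ((r : ℝ) + 1) ^ 2))
        linarith
  have htotal : ∑ f : Fin N → Fin N, ((1 : ℝ) / 4) ^ space f ≤ 81 := by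
    have h1 : ∑ f : Fin N → Fin N, ((1 : ℝ) / 4) ^ space f = ∏ r : Fin N, ∑ v : Fin N, w r v := by
      rw [Finset.prod_univ_sum, Fintype.piFinset_univ]
      exact Finset.sum_congr rfl fun f _ => (hprod f).symm
    rw [h1]
    calc ∏ r : Fin N, ∑ v : Fin N, w r v ≤ ∏ r : Fin N, Real.exp (2 * (1 / ((r : ℝ) + 1) ^ 2)) :=
          Finset.prod_le_prod (fun r _ => Finset.sum_nonneg fun v _ => hw0 _ _) fun r _ => hrow r
      _ = Real.exp (2 * ∑ r ∈ Finset.range N, 1 / ((r : ℝ) + 1) ^ 2) := by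
          rw [← Real.exp_sum, ← Finset.mul_sum,
            Fin.sum_univ_eq_sum_range (fun r => 1 / ((r : ℝ) + 1) ^ 2) N]
      _ ≤ Real.exp 4 := by
          apply Real.exp_le_exp.2
          have := sum_one_div_sq_le N
          have h0 : (0 : ℝ) ≤ 1 / N := by positivity
          linarith
      _ = Real.exp 1 ^ 4 := by rw [← Real.exp_nat_mul]; norm_num
      _ ≤ 3 ^ 4 := by
          gcongr
          have := Real.exp_one_lt_d9
          linarith
      _ = 81 := by norm_num
  have h2 : ((Finset.univ.filter fun f : Fin N → Fin N => space f ≤ σ).card : ℝ) * (1 / 4) ^ σ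
      ≤ ∑ f : Fin N → Fin N, ((1 : ℝ) / 4) ^ space f := by
    rw [← nsmul_eq_mul]
    refine (Finset.card_nsmul_le_sum _ (fun f => ((1 : ℝ) / 4) ^ space f) _ ?_).trans
      (Finset.sum_le_sum_of_subset_of_nonneg (Finset.filter_subset _ _)
        fun f _ _ => by positivity)
    intro f hf
    exact pow_le_pow_of_le_one (by norm_num) (by norm_num) (Finset.mem_filter.1 hf).2
  rw [one_div_pow, mul_one_div, div_le_iff₀ (by positivity)] at h2
  exact h2.trans (by gcongr)

/-- The configurations of space at most `σ` with one of the first `L` instructions to be executed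
next. -/
def smallConfigs (L σ : ℕ) : Set Config := {s | s.pc < L ∧ s.space ≤ σ}

/-- A register in use has address and content of at most σ bits. Reduction modulo 2^σ therefore
changes nothing here; it only makes the map total. -/
theorem exists_smallConfigs_embedding (L σ : ℕ) :
    ∃ φ : Config → ℕ × (Fin (2 ^ σ) → Fin (2 ^ σ)), Set.InjOn φ (smallConfigs L σ) ∧
      ∀ s ∈ smallConfigs L σ, (φ s).1 < L ∧ space (φ s).2 ≤ σ := by
  have hpos : 0 < 2 ^ σ := by positivity
  refine ⟨fun s => (s.pc, fun r => ⟨s.reg r % 2 ^ σ, Nat.mod_lt _ hpos⟩), ?_⟩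
  have hterm : ∀ s : Config, s.space ≤ σ → ∀ r, s.reg r ≠ 0 →
      Nat.size r + Nat.size (s.reg r) ≤ σ := by
    intro s hs r hr
    refine le_trans ?_ hs
    exact Finset.single_le_sum (f := fun r => Nat.size r + Nat.size (s.reg r))
      (fun _ _ => Nat.zero_le _) (Finsupp.mem_support_iff.2 hr)
  have hval : ∀ s : Config, s.space ≤ σ → ∀ r, s.reg r < 2 ^ σ := by
    intro s hs r
    by_cases hr : s.reg r = 0
    · omega
    · exact (Nat.lt_size_self _).trans_le
        (Nat.pow_le_pow_right (by norm_num) (by have := hterm s hs r hr; omega))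
  have haddr : ∀ s : Config, s.space ≤ σ → ∀ r, s.reg r ≠ 0 → r < 2 ^ σ := by
    intro s hs r hr
    exact (Nat.lt_size_self _).trans_le
      (Nat.pow_le_pow_right (by norm_num) (by have := hterm s hs r hr; omega))
  constructor
  · rintro s hs s' hs' h
    simp only [Prod.mk.injEq] at h
    obtain ⟨pc, reg⟩ := s
    obtain ⟨pc', reg'⟩ := s'
    congr 1
    · exact h.1
    · ext r
      by_cases hr : r < 2 ^ σ
      · have h1 := congrArg Fin.val (congrFun h.2 ⟨r, hr⟩)
        simp only at h1
        have h2 := hval _ hs.2 r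
        have h3 := hval _ hs'.2 r
        simp only at h2 h3
        rwa [Nat.mod_eq_of_lt h2, Nat.mod_eq_of_lt h3] at h1
      · have h1 : reg r = 0 := by
          by_contra hc; exact hr (haddr _ hs.2 r hc)
        have h2 : reg' r = 0 := by
          by_contra hc; exact hr (haddr _ hs'.2 r hc)
        rw [h1, h2]
  · intro s hs
    refine ⟨hs.1, le_trans (le_of_eq ?_) hs.2⟩
    simp only [space, Nat.mod_eq_of_lt (hval s hs.2 _)]
    rw [Fin.sum_univ_eq_sum_range
      (fun r => if s.reg r = 0 then 0 else Nat.size r + Nat.size (s.reg r)), Config.space]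
    symm
    apply Finset.sum_subset_zero_on_sdiff
    · intro r hr
      exact Finset.mem_range.2 (haddr s hs.2 r (Finsupp.mem_support_iff.1 hr))
    · intro r hr
      have := (Finset.mem_sdiff.1 hr).2
      rw [Finsupp.mem_support_iff, not_not] at this
      rw [if_pos this]
    · intro r hr
      rw [if_neg (Finsupp.mem_support_iff.1 hr)]

theorem exists_finset_smallConfigs (L σ : ℕ) :
    ∃ A : Finset Config, (∀ s, s ∈ A ↔ s ∈ smallConfigs L σ) ∧ (A.card : ℝ) ≤ 81 * L * 4 ^ σ := by
  classical
  obtain ⟨φ, hinj, hmap⟩ := exists_smallConfigs_embedding L σ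
  let B := Finset.range L ×ˢ (Finset.univ.filter fun f : Fin (2 ^ σ) → Fin (2 ^ σ) => space f ≤ σ)
  have hB : ∀ s ∈ smallConfigs L σ, φ s ∈ B := by
    intro s hs
    have := hmap s hs
    simp [B, this.1, this.2]
  have hfin : (smallConfigs L σ).Finite :=
    Set.Finite.of_finite_image (B.finite_toSet.subset (by rintro _ ⟨s, hs, rfl⟩; exact hB s hs)) hinj
  refine ⟨hfin.toFinset, fun s => hfin.mem_toFinset, ?_⟩
  have h1 : hfin.toFinset.card ≤ B.card := by
    apply Finset.card_le_card_of_injOn φ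
    · intro s hs
      exact hB s (by simpa using hs)
    · intro s hs s' hs' h
      exact hinj (by simpa using hs) (by simpa using hs') h
  have h2 : (B.card : ℝ) = L * (Finset.univ.filter fun f : Fin (2 ^ σ) → Fin (2 ^ σ) =>
      space f ≤ σ).card := by
    simp only [B, Finset.card_product, Finset.card_range]
    push_cast
    rfl
  calc (hfin.toFinset.card : ℝ) ≤ B.card := by exact_mod_cast h1
    _ ≤ L * (81 * 4 ^ σ) := by rw [h2]; gcongr; exact card_space_le _ _
    _ = _ := by ring

theorem config_add (M : Program) (w : ℕ → ℕ) (s t : ℕ) :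
    config M w (s + t) = (step M w)^[t] (config M w s) := by
  unfold config
  rw [add_comm, Function.iterate_add_apply]

theorem step_of_halted {M : Program} {w : ℕ → ℕ} {s : Config} (h : Halted M s) :
    step M w s = s := by
  have : M[s.pc]? = none := List.getElem?_eq_none h
  unfold step
  rw [this]

theorem halted_config {M : Program} {w : ℕ → ℕ} {τ t : ℕ} (h : Halted M (config M w τ))
    (ht : τ ≤ t) : Halted M (config M w t) := by
  obtain ⟨k, rfl⟩ := Nat.exists_eq_add_of_le ht
  rw [config_add, Function.iterate_fixed (step_of_halted h)]
  exact h

/-- Before halting no configuration is repeated. -/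
theorem config_injOn {M : Program} {w : ℕ → ℕ} {τ : ℕ} (h : Halted M (config M w τ))
    (h' : ∀ t < τ, ¬ Halted M (config M w t)) :
    Set.InjOn (config M w) (Finset.range τ : Set ℕ) := by
  have key : ∀ s t, s < t → t < τ → config M w s ≠ config M w t := by
    intro s t hst ht heq
    -- A configuration repeated at s < t would lead to halting t - s steps before τ.
    apply h' (s + (τ - t)) (by omega)
    rw [config_add, heq, ← config_add, Nat.add_sub_cancel' ht.le]
    exact h
  intro s hs t ht heq
  simp only [Finset.coe_range, Set.mem_Iio] at hs ht
  rcases lt_trichotomy s t with hlt | rfl | hlt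
  · exact absurd heq (key s t hlt ht)
  · rfl
  · exact absurd heq.symm (key t s hlt hs)

/-- A halting computation of length at least `n ^ 2` uses logarithmic space most of the time. -/
theorem time_mul_log_le {M : Program} {w : ℕ → ℕ} {τ L n : ℕ} (hL : M.length ≤ L)
    (h : Halted M (config M w τ)) (h' : ∀ t < τ, ¬ Halted M (config M w t))
    (hn : n * n ≤ τ) (hnL : 162 * L + 2 ≤ n) :
    (τ : ℝ) * Real.logb 2 n ≤ 4 * ∑ t ∈ Finset.range τ, ((config M w t).space : ℝ) := by
  classical
  -- By 4^σ ≤ n, at most 81Ln ≤ n²/2 ≤ τ/2 configurations have space at most σ, and none recurs. So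
  -- at least half of the times use space σ + 1 or more, which is at least half of log₂ n.
  set σ := Nat.log 4 n with hσ
  have hn0 : n ≠ 0 := by omega
  have hn0' : (0 : ℝ) < n := by exact_mod_cast Nat.pos_of_ne_zero hn0
  have h4 : 4 ^ σ ≤ n := Nat.pow_log_le_self 4 hn0
  have hlg : Real.logb 2 n ≤ 2 * (σ + 1) := by
    rw [Real.logb_le_iff_le_rpow (by norm_num) hn0']
    have h1 : n < 4 ^ (σ + 1) := Nat.lt_pow_succ_log_self (by norm_num) n
    have h2 : (2 : ℝ) ^ (2 * ((σ : ℝ) + 1)) = ((4 ^ (σ + 1) : ℕ) : ℝ) := by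
      rw [Real.rpow_mul (by norm_num)]
      push_cast
      rw [← Real.rpow_natCast]
      norm_num
    rw [h2]
    exact_mod_cast h1.le
  obtain ⟨A, hA, hAc⟩ := exists_finset_smallConfigs L σ
  let E := (Finset.range τ).filter fun t => (config M w t).space ≤ σ
  have hE : E.card ≤ A.card := by
    apply Finset.card_le_card_of_injOn (config M w)
    · intro t ht
      have ht' := Finset.mem_filter.1 (Finset.mem_coe.1 ht)
      have h3 := h' t (Finset.mem_range.1 ht'.1)
      rw [Halted, not_le] at h3
      exact (hA _).2 ⟨h3.trans_le hL, ht'.2⟩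
    · exact (config_injOn h h').mono (by exact_mod_cast Finset.filter_subset _ _)
  have hE2 : 2 * (E.card : ℝ) ≤ τ := by
    have h5 : (4 : ℝ) ^ σ ≤ n := by exact_mod_cast h4
    have h6 : (n : ℝ) * n ≤ τ := by exact_mod_cast hn
    have h7 : 162 * (L : ℝ) + 2 ≤ n := by exact_mod_cast hnL
    calc 2 * (E.card : ℝ) ≤ 2 * A.card := by gcongr
      _ ≤ 2 * (81 * L * 4 ^ σ) := by gcongr
      _ ≤ 2 * (81 * L * n) := by gcongr
      _ ≤ n * n := by nlinarith
      _ ≤ τ := h6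
  let E' := (Finset.range τ).filter fun t => ¬ (config M w t).space ≤ σ
  have hEE : E.card + E'.card = τ := by
    exact (Finset.card_filter_add_card_filter_not
      (fun t => (config M w t).space ≤ σ)).trans (Finset.card_range τ)
  have hEE' : (E.card : ℝ) + E'.card = τ := by exact_mod_cast hEE
  have hsum : (E'.card : ℝ) * (σ + 1) ≤ ∑ t ∈ Finset.range τ, ((config M w t).space : ℝ) := by
    rw [← nsmul_eq_mul]
    refine (Finset.card_nsmul_le_sum E' (fun t => ((config M w t).space : ℝ)) _ ?_).trans
      (Finset.sum_le_sum_of_subset_of_nonneg (Finset.filter_subset _ _)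
        fun t _ _ => Nat.cast_nonneg _)
    intro t ht
    have := (Finset.mem_filter.1 ht).2
    exact_mod_cast (by omega : σ + 1 ≤ (config M w t).space)
  have hσ0 : (0 : ℝ) ≤ σ := Nat.cast_nonneg _
  calc (τ : ℝ) * Real.logb 2 n ≤ τ * (2 * (σ + 1)) := by gcongr
    _ ≤ 4 * (E'.card * (σ + 1)) := by nlinarith
    _ ≤ _ := by linarith

end RAM

/-! ### The bounds for the two models -/

namespace MatMul

variable {F : Type*} {n : ℕ} {D : Finset F}

/-- The input coordinate stored in cell `k`. -/
def cell (n k : ℕ) : Option (Idx n) :=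
  if h : k < n * n then some (.inl (finProdFinEquiv.symm ⟨k, h⟩))
  else if h : k - n * n < n * n then some (.inr (finProdFinEquiv.symm ⟨k - n * n, h⟩))
  else none

theorem tape_congr (enc : F ↪ ℕ) (x y : Idx n → D) (k : ℕ) (h : ∀ i ∈ cell n k, x i = y i) :
    tape enc x k = tape enc y k := by
  unfold tape
  unfold cell at h
  split_ifs at h ⊢ with h1 h2
  · rw [h _ rfl]
  · rw [h _ rfl]
  · rfl

theorem one_div_pow_mul_card_le {C : ℕ} {c : ℝ} (hc : c ≤ C) (hn : 1 ≤ n)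
    {E : (Idx n → D) → Prop} (hD : 1 ≤ D.card) (h : (n : ℝ) ^ (-c) ≤ prob E) :
    (Nat.card (Idx n → D) : ℝ) / n ^ C ≤ Nat.card {x | E x} := by
  have hn' : (1 : ℝ) ≤ n := by exact_mod_cast hn
  have h1 : 1 / (n : ℝ) ^ C ≤ (n : ℝ) ^ (-c) := by
    rw [one_div, ← Real.rpow_natCast, ← Real.rpow_neg (by linarith)]
    exact Real.rpow_le_rpow_of_exponent_le hn' (by linarith)
  have hne : Nonempty (Idx n → D) := by
    obtain ⟨a, ha⟩ := Finset.card_pos.1 hD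
    exact ⟨fun _ => ⟨a, ha⟩⟩
  have hpos : (0 : ℝ) < Nat.card (Idx n → D) := by exact_mod_cast Nat.card_pos
  have h2 := h1.trans h
  rw [prob, le_div_iff₀ hpos] at h2
  rw [div_eq_mul_one_div, mul_comm]
  exact h2

theorem prob_nonneg (E : (Idx n → D) → Prop) : 0 ≤ prob E := by
  unfold prob; positivity

theorem prob_le_one (E : (Idx n → D) → Prop) : prob E ≤ 1 := by
  unfold prob
  apply div_le_one_of_le₀ _ (by positivity)
  exact_mod_cast Nat.card_le_card_of_injective (Subtype.val : {x // E x} → _)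
    Subtype.val_injective

theorem logb_card_eq_zero (h : ¬ 2 ≤ D.card) : Real.logb 2 D.card = 0 := by
  rcases (by omega : D.card = 0 ∨ D.card = 1) with h | h <;> simp [h]

/-- A random-access machine as a query machine. -/
noncomputable def ramMachine (M : RAM.Program) (enc : F ↪ ℕ) :
    QueryMachine (Idx n) (Fin n × Fin n) D F where
  State := RAM.Config
  query s := match M[s.pc]? with
    | some (.read _ a) => cell n (s.reg a)
    | _ => none
  step s x := RAM.step M (tape enc x) s
  emit s _ := {e | ∃ a b, M[s.pc]? = some (.write a b) ∧ s.reg a = e.1.1 * n + e.1.2 ∧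
    s.reg b = enc e.2}
  step_congr := by
    intro s x y h
    unfold RAM.step
    split <;> rename_i hM <;> try rfl
    rw [hM] at h
    rw [tape_congr enc x y _ h]
  emit_congr := by
    intro s x y _
    rfl

theorem ramMachine_run (M : RAM.Program) (enc : F ↪ ℕ) (x : Idx n → D) (t : ℕ) :
    (ramMachine M enc).run (⟨0, 0⟩ : RAM.Config) x t = RAM.config M (tape enc x) t := rfl

theorem rowMajor_injective {p q : Fin n × Fin n} (h : (p.1 : ℕ) * n + p.2 = q.1 * n + q.2) :
    p = q := by
  apply finProdFinEquiv.injective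
  apply Fin.ext
  simp only [finProdFinEquiv_apply_val]
  rw [add_comm, mul_comm, h, add_comm, mul_comm]

theorem branchingProgram_bound (c : ℝ) :
    ∃ ε > (0 : ℝ), ∃ n₀ : ℕ, ∀ n ≥ n₀,
      ∀ (F : Type u) [Field F] [Finite F] (D : Finset F)
        (μ : PMF (BranchingProgram (MatMul.Idx n) (Fin n × Fin n) D F)) (T : ℕ) (S : ℝ),
        (∀ P ∈ μ.support, P.time ≤ T ∧ P.cumulativeMemory ≤ S) →
        (n : ℝ) ^ (-c) ≤
          ∑' P, (μ P).toReal * MatMul.prob (fun x => P.Produces x (MatMul.product x)) →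
        ε * ((n : ℝ) ^ 3 * √(Real.logb 2 D.card) / Real.logb 2 n) ≤ T ∨
          ε * ((n : ℝ) ^ 6 * Real.logb 2 D.card) ≤ T * S := by
  obtain ⟨C, hC⟩ := exists_nat_ge c
  obtain ⟨ε, hε, hmain⟩ := exists_cumulative_lower_bound.{u} C
  obtain ⟨n₀, hn₀⟩ := hmain 2
  refine ⟨ε, hε, n₀ + 2, ?_⟩
  intro n hn F _ _ D μ T S hμ hp
  by_cases hD : 2 ≤ D.card
  swap
  · left
    rw [logb_card_eq_zero hD]
    simp
  rw [or_iff_not_imp_left, not_le]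
  intro hT
  obtain ⟨P, hP, hpP⟩ := μ.exists_mem_support_le (fun P => prob_nonneg _) (fun P => prob_le_one _) hp
  obtain ⟨hPT, hPS⟩ := hμ P hP
  have hn0 : (0 : ℝ) < n := by exact_mod_cast (by omega : 0 < n)
  have hlg1 : 1 ≤ Real.logb 2 n := by
    rw [Real.le_logb_iff_rpow_le (by norm_num) hn0]
    simpa using (by omega : 2 ≤ n)
  -- Since log₂ n ≥ 1, the threshold with log n under the root is the weaker restriction.
  have hT' : (T : ℝ) ≤ ε * (n ^ 3 * √(Real.logb 2 D.card / Real.logb 2 n)) := by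
    refine hT.le.trans ?_
    rw [mul_div_assoc, Real.sqrt_div' _ (by linarith)]
    gcongr
    rw [Real.sqrt_le_left (by linarith)]
    nlinarith
  obtain ⟨x, hx, hle⟩ := hn₀ n (by omega) F D hD P.toQueryMachine P.rootState P.cheapStates
    P.card_cheapStates_le {x | P.Produces x (product x)} (fun _ => P.time)
    (fun _ t => Real.logb 2 (P.width t)) T hT' (fun _ _ => hPT)
    (fun _ _ t => P.logb_width_nonneg t) (fun _ _ => by simp [P.width_zero])
    (fun x _ s _ y hy => P.run_mem_cheapStates x s y hy)
    (by
      intro x hx t e he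
      obtain ⟨ht, v, i, hv, hq, he⟩ := (P.mem_emit_run_iff x t e).1 he
      exact (hx e.1 e.2).1 ⟨t, ht, v, i, hv, hq, he⟩)
    (by
      intro x hx j
      obtain ⟨t, ht, v, i, hv, hq, he⟩ := (hx j (product x j)).2 rfl
      exact ⟨t, ht, _, (P.mem_emit_run_iff x t _).2 ⟨ht, v, i, hv, hq, he⟩⟩)
    (one_div_pow_mul_card_le hC (by omega) (by omega) hpP)
  refine hle.trans (mul_le_mul_of_nonneg_left ?_ (Nat.cast_nonneg _))
  refine le_trans ?_ hPS
  unfold BranchingProgram.cumulativeMemory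
  rw [Finset.sum_range_succ]
  have := P.logb_width_nonneg P.time
  linarith

/-- A write step states one row-major index, which identifies the entry, so distinct entries need
distinct steps. -/
theorem sq_le_card_time {M : RAM.Program} {enc : F ↪ ℕ} {x : Idx n → D}
    {τ : ℕ} (h : ∀ j : Fin n × Fin n, ∃ t < τ, ∃ o, (j, o) ∈ (ramMachine M enc).emit
      ((ramMachine M enc).run (⟨0, 0⟩ : RAM.Config) x t) x) : n * n ≤ τ := by
  choose t ht o ho using h
  have : (Finset.univ : Finset (Fin n × Fin n)).card ≤ (Finset.range τ).card := by
    apply Finset.card_le_card_of_injOn t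
    · intro j _
      simpa using ht j
    · intro j _ j' _ hjj
      obtain ⟨a, b, h1, h2, -⟩ := ho j
      obtain ⟨a', b', h1', h2', -⟩ := ho j'
      simp only [hjj] at h1 h2
      rw [h1] at h1'
      simp only [Option.some.injEq, RAM.Instr.write.injEq] at h1'
      rw [← h1'.1, h2] at h2'
      exact rowMajor_injective h2'
  simpa using this

/-- If T · S were too small, τ lg ≤ 4S and τ ≤ T would give τ² lg ≤ 4TS, hence τ ≤ ε n³ √(l/lg) on
every successful input. The core bound then applies without an assumption on time. -/
theorem ram_bound (c : ℝ) :
    ∃ ε > (0 : ℝ), ∀ L : ℕ, ∃ n₀ : ℕ, ∀ n ≥ n₀,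
      ∀ (F : Type u) [Field F] [Finite F] (D : Finset F) (enc : F ↪ ℕ)
        (μ : PMF RAM.Program) (T S : ℕ),
        (∀ M ∈ μ.support, M.length ≤ L ∧
          ∀ x : MatMul.Idx n → D, RAM.RunsWithin M (MatMul.tape enc x) T S) →
        (n : ℝ) ^ (-c) ≤
          ∑' M, (μ M).toReal *
            MatMul.prob (fun x : MatMul.Idx n → D => MatMul.RAMProduces M enc x) →
        ε * ((n : ℝ) ^ 6 * Real.logb 2 D.card) ≤ T * S := by
  obtain ⟨C, hC⟩ := exists_nat_ge c
  obtain ⟨ε, hε, hmain⟩ := exists_cumulative_lower_bound.{u} C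
  -- The first constant serves the bound on τ; the second makes up for a cost equal to twice the
  -- space.
  refine ⟨min (ε ^ 2 / 4) (ε / 2), by positivity, fun L => ?_⟩
  obtain ⟨n₀, hn₀⟩ := hmain (81 * L)
  refine ⟨n₀ + 162 * L + 2, ?_⟩
  intro n hn F _ _ D enc μ T S hμ hp
  by_cases hD : 2 ≤ D.card
  swap
  · rw [logb_card_eq_zero hD]
    simp only [mul_zero]
    positivity
  by_contra hcon
  rw [not_le] at hcon
  obtain ⟨M, hM, hpM⟩ := μ.exists_mem_support_le (fun P => prob_nonneg _) (fun P => prob_le_one _) hp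
  obtain ⟨hML, hrun⟩ := hμ M hM
  choose τ hτT hhalt hnot hspace using hrun
  have hn0 : (0 : ℝ) < n := by exact_mod_cast (by omega : 0 < n)
  have hlg1 : 1 ≤ Real.logb 2 n := by
    rw [Real.le_logb_iff_rpow_le (by norm_num) hn0]
    simpa using (by omega : 2 ≤ n)
  have hl1 : 1 ≤ Real.logb 2 D.card := by
    rw [Real.le_logb_iff_rpow_le (by norm_num) (by exact_mod_cast (by omega : 0 < D.card))]
    simpa using hD
  set l := Real.logb 2 D.card with hl
  set lg := Real.logb 2 n with hlg
  have hall : ∀ x ∈ {x : Idx n → D | RAMProduces M enc x}, ∀ j : Fin n × Fin n,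
      ∃ t < τ x, ∃ o, (j, o) ∈ (ramMachine M enc).emit
        ((ramMachine M enc).run (⟨0, 0⟩ : RAM.Config) x t) x := by
    intro x hx j
    obtain ⟨t, a, b, h1, h2, h3⟩ := (hx (j.1 * n + j.2) (enc (product x j))).2 ⟨j.1, j.2, rfl, rfl⟩
    refine ⟨t, ?_, product x j, a, b, h1, h2, h3⟩
    by_contra ht
    have := RAM.halted_config (hhalt x) (not_lt.1 ht)
    rw [List.getElem?_eq_none this] at h1
    simp at h1
  have hS : ∀ x, ∑ t ∈ Finset.range (τ x), ((RAM.config M (tape enc x) t).space : ℝ) ≤ S := by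
    intro x
    have h1 := hspace x
    rw [Finset.sum_range_succ] at h1
    exact_mod_cast (Nat.le_add_right _ _).trans h1
  have hτ : ∀ x ∈ {x : Idx n → D | RAMProduces M enc x},
      (τ x : ℝ) ≤ ε * (n ^ 3 * √(l / lg)) := by
    intro x hx
    have h1 := RAM.time_mul_log_le hML (hhalt x) (hnot x) (sq_le_card_time (hall x hx))
      (by omega : 162 * L + 2 ≤ n)
    rw [← hlg] at h1
    have h2 : (τ x : ℝ) ≤ T := by exact_mod_cast hτT x
    have h3 : (τ x : ℝ) ^ 2 * lg ≤ ε ^ 2 * (n ^ 6 * l) := by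
      calc (τ x : ℝ) ^ 2 * lg = τ x * (τ x * lg) := by ring
        _ ≤ T * (4 * S) := by
            apply mul_le_mul h2 (h1.trans (by linarith [hS x])) (by positivity) (by positivity)
        _ ≤ 4 * (ε ^ 2 / 4 * (n ^ 6 * l)) := by
            have : min (ε ^ 2 / 4) (ε / 2) * ((n : ℝ) ^ 6 * l) ≤ ε ^ 2 / 4 * (n ^ 6 * l) := by
              gcongr
              exact min_le_left _ _
            linarith
        _ = _ := by ring
    refine le_of_abs_le (abs_le_of_sq_le_sq ?_ (by positivity))
    rw [mul_pow, mul_pow, Real.sq_sqrt (by positivity)]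
    rw [← le_div_iff₀ (by linarith)] at h3
    refine h3.trans (le_of_eq ?_)
    ring
  -- T itself may exceed the threshold; only the running times on successful inputs are known to lie
  -- below it.
  obtain ⟨T', hT'⟩ : ∃ T' : ℕ, T' = min T ⌊ε * (n ^ 3 * √(l / lg))⌋₊ := ⟨_, rfl⟩
  have hT'le : (T' : ℝ) ≤ ε * (n ^ 3 * √(l / lg)) := by
    refine le_trans ?_ (Nat.floor_le (by positivity))
    exact_mod_cast hT' ▸ min_le_right _ _
  have hT'T : (T' : ℝ) ≤ T := by exact_mod_cast hT' ▸ min_le_left _ _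
  choose A hA hAc using RAM.exists_finset_smallConfigs L
  obtain ⟨x, hx, hle⟩ := hn₀ n (by omega) F D hD (ramMachine M enc) (⟨0, 0⟩ : RAM.Config)
    -- About 4^σ = 2^(2σ) configurations have space at most σ, so cost y corresponds to space y/2.
    (fun _ y => A ⌊y / 2⌋₊)
    (by
      intro s y hy
      refine (hAc _).trans ?_
      push_cast
      gcongr
      rw [← Real.rpow_natCast, show (4 : ℝ) = 2 ^ (2 : ℝ) by norm_num, ← Real.rpow_mul (by norm_num)]
      apply Real.rpow_le_rpow_of_exponent_le (by norm_num)
      have := Nat.floor_le (by positivity : 0 ≤ y / 2)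
      linarith)
    {x | RAMProduces M enc x} τ (fun x t => 2 * ((RAM.config M (tape enc x) t).space : ℝ)) T' hT'le
    (by
      intro x hx
      rw [hT']
      exact le_min (hτT x) (Nat.le_floor (hτ x hx)))
    (fun _ _ _ => by positivity)
    (fun x _ => by simp [RAM.config, RAM.Config.space])
    (by
      intro x _ s hs y hy
      refine (hA _ _).2 ⟨?_, ?_⟩
      · have := hnot x s hs
        rw [RAM.Halted, not_le] at this
        exact this.trans_le hML
      · apply Nat.le_floor
        rw [ramMachine_run]
        linarith)
    (by
      rintro x hx t e ⟨a, b, h1, h2, h3⟩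
      rw [ramMachine_run] at h1 h2 h3
      obtain ⟨i, j, hij, hv⟩ := (hx (e.1.1 * n + e.1.2) (enc e.2)).1 ⟨t, a, b, h1, h2, h3⟩
      rw [enc.injective hv]
      have : e.1 = (i, j) := rowMajor_injective hij
      rw [this])
    hall (one_div_pow_mul_card_le hC (by omega) (by omega) hpM)
  rw [← Finset.mul_sum] at hle
  have h1 : ε / 2 * (n ^ 6 * l) ≤ T * S := by
    have h2 : (T' : ℝ) * (2 * ∑ t ∈ Finset.range (τ x), ((RAM.config M (tape enc x) t).space : ℝ))
        ≤ T * (2 * S) := by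
      gcongr
      exact hS x
    linarith
  have h3 : min (ε ^ 2 / 4) (ε / 2) * ((n : ℝ) ^ 6 * l) ≤ ε / 2 * (n ^ 6 * l) := by
    gcongr
    exact min_le_right _ _
  linarith

end MatMul

/-- A randomized program is a probability distribution on deterministic ones. -/
theorem mainTheorem6 (c : ℝ) :
    (∃ ε > (0 : ℝ), ∃ n₀ : ℕ, ∀ n ≥ n₀,
      ∀ (F : Type u) [Field F] [Finite F] (D : Finset F)
        (μ : PMF (BranchingProgram (MatMul.Idx n) (Fin n × Fin n) D F)) (T : ℕ) (S : ℝ),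
        (∀ P ∈ μ.support, P.time ≤ T ∧ P.cumulativeMemory ≤ S) →
        (n : ℝ) ^ (-c) ≤
          ∑' P, (μ P).toReal * MatMul.prob (fun x => P.Produces x (MatMul.product x)) →
        ε * ((n : ℝ) ^ 3 * √(Real.logb 2 D.card) / Real.logb 2 n) ≤ T ∨
          ε * ((n : ℝ) ^ 6 * Real.logb 2 D.card) ≤ T * S) ∧
    (∃ ε > (0 : ℝ), ∀ L : ℕ, ∃ n₀ : ℕ, ∀ n ≥ n₀,
      ∀ (F : Type u) [Field F] [Finite F] (D : Finset F) (enc : F ↪ ℕ)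
        (μ : PMF RAM.Program) (T S : ℕ),
        (∀ M ∈ μ.support, M.length ≤ L ∧
          ∀ x : MatMul.Idx n → D, RAM.RunsWithin M (MatMul.tape enc x) T S) →
        (n : ℝ) ^ (-c) ≤
          ∑' M, (μ M).toReal *
            MatMul.prob (fun x : MatMul.Idx n → D => MatMul.RAMProduces M enc x) →
        ε * ((n : ℝ) ^ 6 * Real.logb 2 D.card) ≤ T * S) :=
  ⟨MatMul.branchingProgram_bound c, MatMul.ram_bound c⟩
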